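/- **Model.** There are $M$ dispatchers and $N$ servers, and time is slotted. In slot $t$, $A^m(t)\in\mathbb{N}$ tasks arrive at dispatcher $m$ and server $n$ offers service $S_n(t)\in\mathbb{N}$. The vectors $(A^1(t),\dots,A^M(t))$ are i.i.d. over slots; the $S_n(t)$ are i.i.d. over slots, independent across servers and independent of the arrivals. With $A_\Sigma=\sum_m A^m$, $\lambda_\Sigma=\mathbb{E}A_\Sigma$, $\mu_n=\mathbb{E}S_n$, $\mu_\Sigma=\sum_n\mu_n$, assume: $\mu_n>0$ for all $n$; $\mathbb{P}(A_\Sigma=0)>0$; there is $p_0>0$ with $\mathbb{P}(A^m>0)\ge p_0$ for all $m$; and $\mathbb{E}e^{\theta_1A_\Sigma}<\infty$, $\mathbb{E}e^{\theta_2S_n}<\infty$ for all $n$, for some $\theta_1,\theta_2>0$. Let $Q_n(t)$ be the queue length of server $n$ and $\widetilde Q^m_n(t)$ the local estimate of it at dispatcher $m$, at the beginning of slot $t$; $Z(t)=(\mathbf{Q}(t),\widetilde{\mathbf{Q}}^1(t),\dots,\widetilde{\mathbf{Q}}^M(t))$. Under an LED policy, in each slot every dispatcher $m$ sends all its arrivals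 to one server, chosen at random with a law $P^m(\cdot\mid\widetilde{\mathbf{Q}}^m(t))$ that depends only on its own estimates (independently over dispatchers, and of the arrivals and services). With $A_n(t)$ the number of tasks sent to server $n$, $Q_n(t+1)=\max\{Q_n(t)+A_n(t)-S_n(t),0\}$. At the end of the slot, by a random rule that may depend on $Z(t)$ and on the arrivals, choices and services of the slot, each estimate $\widetilde Q^m_n$ is either refreshed, i.e. $\widetilde Q^m_n(t+1)=Q_n(t+1)$ (write $\mathcal{I}^m_n(t)=1$), or ($\mathcal{I}^m_n(t)=0$) is left unchanged or increased by the number of tasks that dispatcher $m$ itself has just sent to server $n$. Then $Z$ is a Markov chain; it starts at $0$ (empty queues, zero estimates), and its state space $\mathcal{Z}$ is the set of states that can be reached from $0$. The dispatching strategy of dispatcher $m$ is *tilted* if for every vector $\mathbf{q}\in\mathbb{N}^N$ of estimates there are a permutation $\sigma$ with $q_{\sigma(1)}\le\dots\le q_{\sigma(N)}$ and a $k\in\{2,\dots,N\}$ such that $\Delta_i:=P^m(\sigma(i)\mid\mathbf{q})-\mu_{\sigma(i)}/\mu_\Sigma$ satisfies $\Delta_i\ge0$ for $i<k$ and $\Delta_i\le0$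 for $i\ge k$. **Theorem.** Consider an LED policy in which the dispatching strategy of every dispatcher is tilted. Let $\lambda_\Sigma=\mu_\Sigma-\epsilon$ with $\epsilon>0$, and suppose that there is $p>0$ with $\mathbb{E}[\mathcal{I}^m_n(t)\mid Z(t)=z]\ge p$ for all $z\in\mathcal{Z}$ and all $m,n$. Then: 1. $Z$ is positive recurrent: call $z\in\mathcal{Z}$ essential if $z$ can be reached from every state that can be reached from $z$; then from every state of $\mathcal{Z}$ the set of essential states is entered in finite mean time, and every essential state has a finite mean return time. 2. There is a stationary distribution on $\mathcal{Z}$, and under every stationary distribution on $\mathcal{Z}$ all moments $\mathbb{E}\|\overline{\mathbf{Q}}\|^r$, $r\in\mathbb{N}$, of the (Euclidean) norm of the queue-length vector are finite. 3. If the state $0$ can be reached from every state of $\mathcal{Z}$, then $Z$ is irreducible on $\mathcal{Z}$, every state of $\mathcal{Z}$ has a finite mean return time, and the stationary distribution on $\mathcal{Z}$ is unique. This is so whenever, for every state in $\mathcal{Z}$ with empty queues and all $m,n$, there is a positive probability that in one slot no tasks arrive and $\mathcal{I}^m_n=1$. -/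

import Mathlib

open scoped ENNReal

noncomputable section

/-! ### Countable Markov chains

A time-homogeneous chain on `X` is given by its one-step laws `P : X → PMF X`. -/

namespace MarkovChain

variable {X : Type*}

/-- `y` can be reached from `x` in finitely many (possibly zero) steps of positive probability. -/
def Accessible (P : X → PMF X) (x y : X) : Prop :=
  Relation.ReflTransGen (fun u v => 0 < P u v) x y

/-- The state space of the chain started at `x₀`: all states that can be reached from `x₀`. -/
def reachable (P : X → PMF X) (x₀ : X) : Set X := {x | Accessible P x₀ x}

/-- `avoid P B n x` is the probability, for the chain started at `x`, that none of the states
at the times `1, …, n` lies in `B`. -/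
def avoid (P : X → PMF X) (B : Set X) : ℕ → X → ℝ≥0∞
  | 0, _ => 1
  | n + 1, x => ∑' y, P x y * Bᶜ.indicator (avoid P B n) y

/-- The mean, for the chain started at `x`, of the first time `τ ≥ 1` at which the state lies
in `B`, namely `∑ₙ ℙₓ(τ > n)`. For `B = {x}` this is the mean return time of `x`. -/
def meanHit (P : X → PMF X) (B : Set X) (x : X) : ℝ≥0∞ := ∑' n, avoid P B n x

/-- The states `x` in the state space such that the chain started at `x` can always come back
to `x` (the union of the closed communicating classes). If the state space is one communicating
class, then this is the whole state space. -/
def essential (P : X → PMF X) (x₀ : X) : Set X :=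
  {x | x ∈ reachable P x₀ ∧ ∀ y, Accessible P x y → Accessible P y x}

/-- Any two states of the state space communicate. -/
def IsIrreducible (P : X → PMF X) (x₀ : X) : Prop :=
  ∀ x ∈ reachable P x₀, ∀ y ∈ reachable P x₀, Accessible P x y

/-- Positive recurrence of the chain started at `x₀`, without presupposing irreducibility:
the essential states are entered in finite mean time from every state of the state space, and
each of them has a finite mean return time. -/
structure IsPositiveRecurrent (P : X → PMF X) (x₀ : X) : Prop where
  absorbed : ∀ x ∈ reachable P x₀, meanHit P (essential P x₀) x < ∞
  returns : ∀ x ∈ essential P x₀, meanHit P {x} x < ∞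

/-- `π` is a stationary distribution on the state space of the chain started at `x₀`. -/
def IsSteadyState (P : X → PMF X) (x₀ : X) (π : PMF X) : Prop :=
  π.bind P = π ∧ π.support ⊆ reachable P x₀

end MarkovChain

/-! ### Load balancing with local estimates -/

namespace LED

variable {M N : ℕ}

/-- The law of a family of independent random variables with laws `p i`. -/
def indep {k : ℕ} {β : Type} [Countable β] [MeasurableSpace β] [MeasurableSingletonClass β]
    (p : Fin k → PMF β) : PMF (Fin k → β) :=
  (MeasureTheory.Measure.pi fun i => (p i).toMeasure).toPMF

theorem indep_apply {k : ℕ} {β : Type} [Countable β] [MeasurableSpace β]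
    [MeasurableSingletonClass β] (p : Fin k → PMF β) (f : Fin k → β) :
    indep p f = ∏ i, p i (f i) := by
  simp [indep, MeasureTheory.Measure.toPMF_apply, MeasureTheory.Measure.pi_singleton,
    PMF.toMeasure_apply_singleton]

/-- A state: the true queue lengths of the `N` servers, and for each of the `M` dispatchers its
local estimates of them. -/
abbrev State (M N : ℕ) : Type := (Fin N → ℕ) × (Fin M → Fin N → ℕ)

/-- What happens at the end of a slot to one local estimate: it is kept, or the dispatcher adds
the tasks that it has itself just sent to that server, or it is set to the true queue length. -/
inductive Action
  | keep
  | count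
  | refresh

/-- An LED policy. `dispatch m q` is the law of the server chosen by dispatcher `m` when its
local estimates are `q`. `update z a c s` is the joint law of what is done to the local estimates
at the end of a slot that began in state `z`, in which `a m` tasks arrived at dispatcher `m`,
dispatcher `m` chose server `c m`, and server `n` offered the service `s n`. -/
structure Policy (M N : ℕ) where
  dispatch : Fin M → (Fin N → ℕ) → PMF (Fin N)
  update : State M N → (Fin M → ℕ) → (Fin M → Fin N) → (Fin N → ℕ) →
    PMF (Fin M → Fin N → Action)

/-- Everything that is random in one slot. -/
structure Slot (M N : ℕ) where
  arrivals : Fin M → ℕ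
  choice : Fin M → Fin N
  service : Fin N → ℕ
  action : Fin M → Fin N → Action

/-- The tasks sent from dispatcher `m` to server `n`. -/
def Slot.routed (w : Slot M N) (m : Fin M) (n : Fin N) : ℕ :=
  if w.choice m = n then w.arrivals m else 0

/-- The queue lengths after the slot; the subtraction is truncated at `0`. -/
def Slot.nextQueue (w : Slot M N) (q : Fin N → ℕ) (n : Fin N) : ℕ :=
  q n + ∑ m, w.routed m n - w.service n

/-- The queue dynamics in terms of the unused service. -/
theorem Slot.nextQueue_eq (w : Slot M N) (q : Fin N → ℕ) (n : Fin N) :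
    (w.nextQueue q n : ℤ) = q n + ∑ m, (w.routed m n : ℤ) - w.service n
      + max (w.service n - q n - ∑ m, (w.routed m n : ℤ)) 0 := by
  rw [Slot.nextQueue, ← Nat.cast_sum]
  omega

/-- The local estimates after the slot. -/
def Slot.nextEstimate (w : Slot M N) (z : State M N) (m : Fin M) (n : Fin N) : ℕ :=
  match w.action m n with
  | Action.keep => z.2 m n
  | Action.count => z.2 m n + w.routed m n
  | Action.refresh => w.nextQueue z.1 n

/-- The law of a slot that begins in state `z`: the arrivals with joint law `arr`, the offered
services with laws `svc n` and the choices of the dispatchers are independent. -/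
def slot (arr : PMF (Fin M → ℕ)) (svc : Fin N → PMF ℕ) (pol : Policy M N) (z : State M N) :
    PMF (Slot M N) :=
  arr.bind fun a =>
  (indep fun m => pol.dispatch m (z.2 m)).bind fun c =>
  (indep svc).bind fun s =>
  (pol.update z a c s).map fun u => ⟨a, c, s, u⟩

/-- The one-step law of the Markov chain of queue lengths and local estimates. -/
def step (arr : PMF (Fin M → ℕ)) (svc : Fin N → PMF ℕ) (pol : Policy M N) (z : State M N) :
    PMF (State M N) :=
  (slot arr svc pol z).map fun w => (w.nextQueue z.1, w.nextEstimate z)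

/-- The conditional probability, given that the slot begins in state `z`, that the estimate of
dispatcher `m` for server `n` is set to the true queue length at the end of the slot. -/
def refreshProb (arr : PMF (Fin M → ℕ)) (svc : Fin N → PMF ℕ) (pol : Policy M N)
    (z : State M N) (m : Fin M) (n : Fin N) : ℝ≥0∞ :=
  (slot arr svc pol z).toOuterMeasure {w | w.action m n = Action.refresh}

/-- The mean service rate of server `n`. -/
def serviceRate (svc : Fin N → PMF ℕ) (n : Fin N) : ℝ := ∑' k : ℕ, (svc n k).toReal * k

/-- The mean total number of arrivals in a slot. -/
def arrivalRate (arr : PMF (Fin M → ℕ)) : ℝ :=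
  ∑' a : Fin M → ℕ, (arr a).toReal * ∑ m, (a m : ℝ)

/-- The standing assumptions on the arrivals in a slot. -/
structure ArrivalAssumptions (arr : PMF (Fin M → ℕ)) : Prop where
  none_pos : 0 < arr 0
  each_pos : ∃ p₀ : ℝ, 0 < p₀ ∧ ∀ m, ENNReal.ofReal p₀ ≤ arr.toOuterMeasure {a | 0 < a m}
  light_tail : ∃ θ : ℝ, 0 < θ ∧
    ∑' a : Fin M → ℕ, arr a * ENNReal.ofReal (Real.exp (θ * ∑ m, (a m : ℝ))) < ∞

/-- The standing assumptions on the services offered in a slot. -/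
structure ServiceAssumptions (svc : Fin N → PMF ℕ) : Prop where
  rate_pos : ∀ n, 0 < serviceRate svc n
  light_tail : ∃ θ : ℝ, 0 < θ ∧
    ∀ n, ∑' k : ℕ, svc n k * ENNReal.ofReal (Real.exp (θ * k)) < ∞

/-- The dispatching preference: the excess, over random routing weighted by the service rates
`μ`, of the probability with which the server in position `i` of the order `σ` is chosen. -/
def preference (μ : Fin N → ℝ) (d : PMF (Fin N)) (σ : Equiv.Perm (Fin N)) (i : Fin N) : ℝ :=
  (d (σ i)).toReal - μ (σ i) / ∑ n, μ n

/-- A dispatching strategy is tilted if, whatever the local estimates `q`, for some order `σ` of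
the servers by increasing estimate the preference is nonnegative for the servers before some
position `k` and nonpositive from position `k` on. Positions count from `0`, and `k` is neither
the first position nor beyond the last. -/
def IsTilted (μ : Fin N → ℝ) (d : (Fin N → ℕ) → PMF (Fin N)) : Prop :=
  ∀ q : Fin N → ℕ, ∃ σ : Equiv.Perm (Fin N), Monotone (q ∘ σ) ∧
    ∃ k : Fin N, 1 ≤ (k : ℕ) ∧
      (∀ i, i < k → 0 ≤ preference μ (d q) σ i) ∧
      (∀ i, k ≤ i → preference μ (d q) σ i ≤ 0)

/-- The Euclidean norm of a vector of queue lengths. -/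
def queueNorm (q : Fin N → ℕ) : ℝ := ‖WithLp.toLp 2 fun n => (q n : ℝ)‖

/-- The `r`-th moment of the norm of the queue length vector under `π`. -/
def queueMoment (π : PMF (State M N)) (r : ℕ) : ℝ≥0∞ :=
  ∑' z, π z * ENNReal.ofReal (queueNorm z.1 ^ r)

end LED

end

/-! The Lyapunov function is V = Σ Q_n^(k+2) + c Σ gap^(k+1), where `gap` is the error of a local
estimate. To leading order the queue part drifts by (k+2) Σ Q_n^(k+1) (Σ_m λ_m P^m(n) - μ_n). If
every dispatcher routed at random with weights μ_n, the bracket would be -ε μ_n/μ_Σ. The deviation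
from that routing helps when tested against an increasing function of the estimates
(`IsTilted.sum_le_zero`). Testing against Q instead costs, by a Young inequality, a small multiple
of Σ Q^(k+1) and a multiple of Σ gap^(k+1) (`IsTilted.sum_pow_le`, `exists_mul_add_pow_le`). An
error is reset to 0 with probability at least p and otherwise grows by at most the load of the slot,
whose moments are bounded uniformly in the state, so gap^(k+1) contracts up to a constant
(`exists_gap_drift`). A large c pays for the estimation cost, and V drifts by at most -δ (Σ Q^(k+1)
+ Σ gap^(k+1)) + K (`exists_lyapunov_drift`).

For k = 0 this is a Foster criterion with a finite exceptional set. Irreducibility is not available,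
so finite mean hitting times are transferred from the finite set to the essential states by
discarding its points one at a time (`meanHit_lt_top_of_union`). The normalised excursion measure of
an essential state is stationary, and it is the only stationary law if that state is accessible from
everywhere (`apply_eq_mul_excursion`). For k = r, averaging the drift over many steps under a
stationary law bounds the moments; truncation replaces integrability of V (`mean_le_of_drift`). The
state 0 is reached by draining the queues and then refreshing one estimate after another. -/

noncomputable section

/-! ### Expectations of extended nonnegative functions under a `PMF` -/

namespace MarkovChain

section Mean

variable {α β : Type*}

/-- The expectation of `f` under `p`. -/
def mean (p : PMF α) (f : α → ℝ≥0∞) : ℝ≥0∞ := ∑' x, p x * f x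

theorem mean_const (p : PMF α) (c : ℝ≥0∞) : mean p (fun _ => c) = c := by
  simp [mean, ENNReal.tsum_mul_right, p.tsum_coe]

theorem mean_add (p : PMF α) (f g : α → ℝ≥0∞) :
    mean p (fun x => f x + g x) = mean p f + mean p g := by
  simp [mean, mul_add, ENNReal.tsum_add]

theorem mean_const_mul (p : PMF α) (c : ℝ≥0∞) (f : α → ℝ≥0∞) :
    mean p (fun x => c * f x) = c * mean p f := by
  simp only [mean, ← ENNReal.tsum_mul_left]
  exact tsum_congr fun x => mul_left_comm _ _ _

theorem mean_mul_const (p : PMF α) (f : α → ℝ≥0∞) (c : ℝ≥0∞) :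
    mean p (fun x => f x * c) = mean p f * c := by
  simp only [mean, ← ENNReal.tsum_mul_right, mul_assoc]

theorem mean_sum {ι : Type*} (s : Finset ι) (p : PMF α) (f : ι → α → ℝ≥0∞) :
    mean p (fun x => ∑ i ∈ s, f i x) = ∑ i ∈ s, mean p (f i) := by
  simp only [mean, Finset.mul_sum]
  exact Summable.tsum_finsetSum fun _ _ => ENNReal.summable

theorem mean_mono_of_pos {p : PMF α} {f g : α → ℝ≥0∞} (h : ∀ x, 0 < p x → f x ≤ g x) :
    mean p f ≤ mean p g := by
  refine ENNReal.tsum_le_tsum fun x => ?_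
  rcases eq_or_ne (p x) 0 with hx | hx
  · simp [hx]
  · exact mul_le_mul_right (h x (pos_iff_ne_zero.2 hx)) _

theorem mean_mono {p : PMF α} {f g : α → ℝ≥0∞} (h : ∀ x, f x ≤ g x) : mean p f ≤ mean p g :=
  mean_mono_of_pos fun x _ => h x

theorem mean_congr_of_pos {p : PMF α} {f g : α → ℝ≥0∞} (h : ∀ x, 0 < p x → f x = g x) :
    mean p f = mean p g :=
  le_antisymm (mean_mono_of_pos fun x hx => (h x hx).le)
    (mean_mono_of_pos fun x hx => (h x hx).ge)

theorem mean_pos {p : PMF α} {f : α → ℝ≥0∞} {x : α} (hp : 0 < p x) (hf : 0 < f x) :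
    0 < mean p f :=
  (ENNReal.mul_pos hp.ne' hf.ne').trans_le (ENNReal.le_tsum x)

theorem mean_bind (p : PMF α) (k : α → PMF β) (f : β → ℝ≥0∞) :
    mean (p.bind k) f = mean p fun x => mean (k x) f := by
  simp only [mean, PMF.bind_apply, ← ENNReal.tsum_mul_right, ← ENNReal.tsum_mul_left]
  rw [ENNReal.tsum_comm]
  simp only [mul_assoc]

theorem mean_pure (x : α) (f : α → ℝ≥0∞) : mean (PMF.pure x) f = f x := by
  rw [mean, tsum_eq_single x]
  · simp
  · intro y hy
    simp [PMF.pure_apply, hy]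

theorem mean_map (p : PMF α) (g : α → β) (f : β → ℝ≥0∞) :
    mean (p.map g) f = mean p fun x => f (g x) := by
  rw [← PMF.bind_pure_comp, mean_bind]
  simp only [Function.comp, mean_pure]

theorem mean_indicator_one (p : PMF α) (s : Set α) :
    mean p (s.indicator fun _ => 1) = p.toOuterMeasure s := by
  rw [PMF.toOuterMeasure_apply]
  refine tsum_congr fun x => ?_
  by_cases hx : x ∈ s <;> simp [hx]

end Mean

/-! ### Hitting times of countable Markov chains -/

variable {X : Type*} {P : X → PMF X}

theorem Accessible.trans {x y z : X} (h : Accessible P x y) (h' : Accessible P y z) :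
    Accessible P x z :=
  Relation.ReflTransGen.trans h h'

theorem Accessible.of_pos {x y : X} (h : 0 < P x y) : Accessible P x y :=
  Relation.ReflTransGen.single h

theorem Accessible.head {x y z : X} (h : 0 < P x y) (h' : Accessible P y z) : Accessible P x z :=
  Relation.ReflTransGen.head h h'

theorem Accessible.refl (x : X) : Accessible P x x := Relation.ReflTransGen.refl

theorem avoid_zero (B : Set X) (x : X) : avoid P B 0 x = 1 := rfl

theorem avoid_succ (B : Set X) (n : ℕ) (x : X) :
    avoid P B (n + 1) x = mean (P x) (Bᶜ.indicator (avoid P B n)) := rfl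

theorem avoid_le_one (B : Set X) (n : ℕ) (x : X) : avoid P B n x ≤ 1 := by
  induction n generalizing x with
  | zero => exact le_rfl
  | succ n ih =>
    rw [avoid_succ]
    calc _ ≤ mean (P x) fun _ => 1 :=
          mean_mono fun y => (Set.indicator_le_self' (fun _ _ => zero_le) y).trans (ih y)
      _ = 1 := mean_const _ _

theorem avoid_anti {B C : Set X} (h : B ⊆ C) (n : ℕ) (x : X) : avoid P C n x ≤ avoid P B n x := by
  induction n generalizing x with
  | zero => exact le_rfl
  | succ n ih =>
    rw [avoid_succ, avoid_succ]
    refine mean_mono fun y => ?_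
    by_cases hy : y ∈ C
    · simp [hy]
    · have hy' : y ∉ B := fun h' => hy (h h')
      simpa [hy, hy'] using ih y

theorem meanHit_anti {B C : Set X} (h : B ⊆ C) (x : X) : meanHit P C x ≤ meanHit P B x :=
  ENNReal.tsum_le_tsum fun n => avoid_anti h n x

/-- The mean of the first time in `B`, cut off at `n`. -/
def meanHitUpTo (P : X → PMF X) (B : Set X) (n : ℕ) (x : X) : ℝ≥0∞ :=
  ∑ k ∈ Finset.range n, avoid P B k x

theorem meanHitUpTo_succ (B : Set X) (n : ℕ) (x : X) :
    meanHitUpTo P B (n + 1) x = 1 + mean (P x) (Bᶜ.indicator (meanHitUpTo P B n)) := by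
  rw [meanHitUpTo, Finset.sum_range_succ', avoid_zero, add_comm]
  congr 1
  simp only [avoid_succ]
  rw [← mean_sum]
  congr 1
  funext y
  by_cases hy : y ∈ B <;> simp [hy, meanHitUpTo]

theorem meanHitUpTo_le_meanHit (B : Set X) (n : ℕ) (x : X) :
    meanHitUpTo P B n x ≤ meanHit P B x :=
  ENNReal.sum_le_tsum _

theorem meanHitUpTo_mono (B : Set X) {m n : ℕ} (h : m ≤ n) (x : X) :
    meanHitUpTo P B m x ≤ meanHitUpTo P B n x :=
  Finset.sum_le_sum_of_subset (Finset.range_mono h)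

/-- Finiteness of the cut-off mean permits cancellation in `ℝ≥0∞` before the mean hitting time
itself is known to be finite. -/
theorem meanHitUpTo_lt_top (B : Set X) (n : ℕ) (x : X) : meanHitUpTo P B n x < ∞ :=
  ENNReal.sum_lt_top.2 fun k _ => (avoid_le_one B k x).trans_lt ENNReal.one_lt_top

theorem meanHit_le_of_forall {B : Set X} {x : X} {c : ℝ≥0∞} (h : ∀ n, meanHitUpTo P B n x ≤ c) :
    meanHit P B x ≤ c := by
  rw [meanHit, ENNReal.tsum_eq_iSup_nat]
  exact iSup_le h

/-- The Foster–Lyapunov criterion on a closed set `R` of states. -/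
theorem meanHit_le_of_drift {R F : Set X} (hR : ∀ x ∈ R, ∀ y, 0 < P x y → y ∈ R)
    {V : X → ℝ≥0∞} (hV : ∀ x ∈ R, x ∉ F → mean (P x) V + 1 ≤ V x) :
    ∀ x ∈ R, meanHit P F x ≤ 1 + mean (P x) V := by
  intro x hx
  refine meanHit_le_of_forall fun n => ?_
  induction n generalizing x with
  | zero => simp [meanHitUpTo]
  | succ n ih =>
    rw [meanHitUpTo_succ]
    gcongr 1 + ?_
    refine mean_mono_of_pos fun y hy => ?_
    by_cases hyF : y ∈ F
    · simp [hyF]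
    · have hyR := hR x hx y hy
      -- Off `F` the drift condition turns the induction bound `1 + mean (P y) V` into `V y`.
      simpa [hyF] using (ih y hyR).trans ((add_comm _ _).trans_le (hV y hyR hyF))

/-- A set that is hit in finite mean time can be reached. -/
theorem exists_accessible_of_meanHit_lt_top {B : Set X} {x : X} (h : meanHit P B x < ∞) :
    ∃ b ∈ B, Accessible P x b := by
  by_contra! hB
  have key : ∀ n y, Accessible P x y → avoid P B n y = 1 := by
    intro n
    induction n with
    | zero => exact fun _ _ => rfl
    | succ n ih =>
      intro y hy
      rw [avoid_succ, ← mean_const (P y) 1]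
      refine mean_congr_of_pos fun w hw => ?_
      have hxw := hy.trans (.of_pos hw)
      have hwB : w ∉ B := fun hwB => hB w hwB hxw
      simpa [hwB] using ih w hxw
  refine h.ne ?_
  simp [meanHit, key _ x (.refl x)]

/-! ### Discarding points from the target of a hitting time -/

/-- The probability that the chain started at `x` enters `A ∪ B` within `n` steps, and that it
does so in `A`, for disjoint `A` and `B`. -/
def enters (P : X → PMF X) (A B : Set X) : ℕ → X → ℝ≥0∞
  | 0, _ => 0
  | n + 1, x => mean (P x) fun y =>
      A.indicator (fun _ => 1) y + (A ∪ B)ᶜ.indicator (enters P A B n) y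

theorem enters_succ (A B : Set X) (n : ℕ) (x : X) : enters P A B (n + 1) x =
    mean (P x) fun y => A.indicator (fun _ => 1) y + (A ∪ B)ᶜ.indicator (enters P A B n) y := rfl

theorem enters_mono (A B : Set X) (x : X) : Monotone fun n => enters P A B n x := by
  refine monotone_nat_of_le_succ fun n => ?_
  induction n generalizing x with
  | zero => exact zero_le
  | succ n ih =>
    refine mean_mono fun y => ?_
    gcongr
    exact ih y

theorem enters_add_enters_le_one {A B : Set X} (hAB : Disjoint A B) (n : ℕ) (x : X) :
    enters P A B n x + enters P B A n x ≤ 1 := by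
  induction n generalizing x with
  | zero => simp [enters]
  | succ n ih =>
    rw [enters_succ, enters_succ, ← mean_add]
    refine (mean_mono fun y => ?_).trans_eq (mean_const (P x) 1)
    by_cases hA : y ∈ A
    · have hB : y ∉ B := hAB.notMem_of_mem_left hA
      simp [hA, hB]
    · by_cases hB : y ∈ B
      · simp [hA, hB]
      · simpa [hA, hB] using ih y

/-- After its last visit to `f`, a path to `T` enters `T` without seeing `f` again. The induction
runs backwards from `t`; the third alternative records that such a visit has been found. -/
theorem exists_enters_pos {T : Set X} {f t : X} (hf : f ∉ T) (ht : t ∈ T)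
    (h : Accessible P f t) : ∃ n, 0 < enters P T {f} n f := by
  have key : ∀ x, Accessible P x t →
      x ∈ T ∨ (∃ n, 0 < enters P T {f} n x) ∨ ∃ n, 0 < enters P T {f} n f := by
    intro x hx
    induction hx using Relation.ReflTransGen.head_induction_on with
    | refl => exact Or.inl ht
    | @head x y hxy _ ih =>
      rcases ih with hy | ⟨n, hn⟩ | hn
      · refine Or.inr (Or.inl ⟨1, ?_⟩)
        rw [enters_succ]
        exact mean_pos hxy (by simp [hy])
      · by_cases hyT : y ∈ T
        · refine Or.inr (Or.inl ⟨1, ?_⟩)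
          rw [enters_succ]
          exact mean_pos hxy (by simp [hyT])
        by_cases hyf : y = f
        · exact Or.inr (Or.inr ⟨n, hyf ▸ hn⟩)
        · refine Or.inr (Or.inl ⟨n + 1, ?_⟩)
          rw [enters_succ]
          exact mean_pos hxy (by simpa [hyT, hyf] using hn)
      · exact Or.inr (Or.inr hn)
  rcases key f h with h | h | h
  exacts [absurd h hf, h, h]

/-- Markov property at the first visit to `f`: if `f` is entered before `T`, the wait for `T` starts
afresh from `f`, and allowing it the full cut-off `n` only increases the bound. -/
theorem meanHitUpTo_le_add_enters (T : Set X) {f : X} (hf : f ∉ T) (n : ℕ) (x : X) :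
    meanHitUpTo P T n x ≤
      meanHitUpTo P (insert f T) n x + enters P {f} T n x * meanHitUpTo P T n f := by
  induction n generalizing x with
  | zero => simp [meanHitUpTo]
  | succ n ih =>
    have hmono := meanHitUpTo_mono (P := P) T n.le_succ f
    refine le_trans ?_ (add_le_add_right (mul_le_mul_right hmono _) _)
    rw [meanHitUpTo_succ, meanHitUpTo_succ, enters_succ, add_assoc, ← mean_mul_const, ← mean_add]
    gcongr 1 + ?_
    refine mean_mono fun y => ?_
    by_cases hyT : y ∈ T
    · simp [hyT]
    · by_cases hyf : y = f
      · subst hyf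
        simp [hyT]
      · simpa [hyT, hyf] using ih y

theorem meanHit_le_of_insert (T : Set X) {f : X} (hf : f ∉ T) (x : X) :
    meanHit P T x ≤ meanHit P (insert f T) x + meanHit P T f := by
  refine meanHit_le_of_forall fun n => (meanHitUpTo_le_add_enters T hf n x).trans ?_
  gcongr
  · exact meanHitUpTo_le_meanHit _ _ _
  · calc _ ≤ 1 * meanHitUpTo P T n f := by
          gcongr
          exact le_self_add.trans
            (enters_add_enters_le_one (Set.disjoint_singleton_left.2 hf) n x)
      _ ≤ _ := (one_mul _).trans_le (meanHitUpTo_le_meanHit _ _ _)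

/-- If `T ∪ {f}` is hit in finite mean time from `f`, and `T` can be reached from `f`, then `T` is
hit in finite mean time from `f`. -/
theorem meanHit_lt_top_of_insert {T : Set X} {f t : X} (hf : f ∉ T) (ht : t ∈ T)
    (h : Accessible P f t) (hfin : meanHit P (insert f T) f < ∞) : meanHit P T f < ∞ := by
  obtain ⟨n₀, hn₀⟩ := exists_enters_pos hf ht h
  have hdisj : Disjoint {f} T := Set.disjoint_singleton_left.2 hf
  -- Let `u` and `v` be the probabilities of entering `{f}` first and `T` first, and `H` the mean
  -- hitting time of `insert f T`. Then `g ≤ H + u * g` and `v * g + u * g ≤ g`, so `v * g ≤ H`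
  -- after cancelling the finite `u * g`.
  have key : ∀ n, meanHitUpTo P T n f * enters P T {f} n₀ f ≤ meanHit P (insert f T) f := by
    intro n
    set k := max n n₀
    set g := meanHitUpTo P T k f
    have h₁ : g ≤ meanHit P (insert f T) f + enters P {f} T k f * g :=
      (meanHitUpTo_le_add_enters T hf k f).trans
        (add_le_add_left (meanHitUpTo_le_meanHit _ _ _) _)
    have h₂ : enters P T {f} k f * g + enters P {f} T k f * g ≤ g := by
      rw [← add_mul, add_comm]
      exact (mul_le_mul_left (enters_add_enters_le_one hdisj k f) g).trans_eq (one_mul g)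
    have hu : enters P {f} T k f * g ≠ ∞ :=
      (le_add_self.trans h₂).trans_lt (meanHitUpTo_lt_top T k f) |>.ne
    have h₃ := (ENNReal.add_le_add_iff_right hu).1 (h₂.trans h₁)
    refine le_trans ?_ h₃
    rw [mul_comm]
    exact mul_le_mul' (enters_mono T {f} f (le_max_right n n₀))
      (meanHitUpTo_mono T (le_max_left n n₀) f)
  have hsup : meanHit P T f * enters P T {f} n₀ f ≤ meanHit P (insert f T) f := by
    rw [meanHit, ENNReal.tsum_eq_iSup_nat, ENNReal.iSup_mul]
    exact iSup_le key
  by_contra htop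
  rw [not_lt, top_le_iff] at htop
  rw [htop, ENNReal.top_mul hn₀.ne'] at hsup
  exact hfin.not_ge hsup

/-- The points of `F` are dropped one by one. Dropping `f` keeps the mean time from `f` finite
because `B` is accessible from it, and adds at most that time to the mean from any other state. -/
theorem meanHit_lt_top_of_union (B : Set X) (F : Finset X)
    (hacc : ∀ f ∈ F, ∃ t ∈ B, Accessible P f t) (hF : ∀ f ∈ F, meanHit P (B ∪ F) f < ∞)
    {x : X} (hx : meanHit P (B ∪ F) x < ∞) : meanHit P B x < ∞ := by
  classical
  induction F using Finset.induction_on generalizing x with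
  | empty => simpa using hx
  | insert f G _ ih =>
    have hset : B ∪ ((insert f G : Finset X) : Set X) = insert f (B ∪ G) := by
      rw [Finset.coe_insert, Set.union_insert]
    rw [hset] at hF hx
    have haccG : ∀ g ∈ G, ∃ t ∈ B, Accessible P g t := fun g hg =>
      hacc g (Finset.mem_insert_of_mem hg)
    by_cases hf : f ∈ B ∪ (G : Set X)
    · rw [Set.insert_eq_of_mem hf] at hF hx
      exact ih haccG (fun g hg => hF g (Finset.mem_insert_of_mem hg)) hx
    · obtain ⟨t, ht, hft⟩ := hacc f (Finset.mem_insert_self f G)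
      have hff := meanHit_lt_top_of_insert hf (Or.inl ht) hft (hF f (Finset.mem_insert_self f G))
      have hall : ∀ y, meanHit P (insert f (B ∪ (G : Set X))) y < ∞ →
          meanHit P (B ∪ (G : Set X)) y < ∞ := fun y hy =>
        (meanHit_le_of_insert _ hf y).trans_lt (ENNReal.add_lt_top.2 ⟨hy, hff⟩)
      exact ih haccG (fun g hg => hall g (hF g (Finset.mem_insert_of_mem hg))) (hall x hx)

/-- Under a Foster–Lyapunov drift towards a finite set `F` of states of a closed set `R`, any set
that can be reached from all states of `F ∩ R` is hit in finite mean time. -/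
theorem meanHit_lt_top_of_drift {R F : Set X} (hR : ∀ x ∈ R, ∀ y, 0 < P x y → y ∈ R)
    (hF : F.Finite) {V : X → ℝ≥0∞} (hV : ∀ x ∈ R, x ∉ F → mean (P x) V + 1 ≤ V x)
    (hfin : ∀ x ∈ R, mean (P x) V < ∞) {B : Set X}
    (hB : ∀ f ∈ F, f ∈ R → ∃ t ∈ B, Accessible P f t) {x : X} (hx : x ∈ R) :
    meanHit P B x < ∞ := by
  have hFR : (F ∩ R).Finite := hF.subset Set.inter_subset_left
  have hhit : ∀ y ∈ R, meanHit P (B ∪ (hFR.toFinset : Set X)) y < ∞ := by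
    intro y hy
    rw [hFR.coe_toFinset]
    refine (meanHit_anti Set.subset_union_right y).trans_lt
      ((meanHit_le_of_drift (F := F ∩ R) hR (V := V) (fun w hw hwF => hV w hw fun h => hwF ⟨h, hw⟩) y
        hy).trans_lt ?_)
    exact ENNReal.add_lt_top.2 ⟨ENNReal.one_lt_top, hfin y hy⟩
  refine meanHit_lt_top_of_union B hFR.toFinset ?_ ?_ (hhit x hx)
  · intro f hf
    rw [Set.Finite.mem_toFinset] at hf
    exact hB f hf.1 hf.2
  · intro f hf
    rw [Set.Finite.mem_toFinset] at hf
    exact hhit f hf.2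

theorem reachable_closed (x₀ : X) : ∀ x ∈ reachable P x₀, ∀ y, 0 < P x y → y ∈ reachable P x₀ :=
  fun _ hx _ hy => Accessible.trans hx (.of_pos hy)

/-! ### Positive recurrence from a drift condition -/

section Drift

variable {x₀ : X} {F : Set X} {V : X → ℝ≥0∞}

/-- Under a Foster–Lyapunov drift towards a finite set, an essential state can be reached from
every state. -/
theorem exists_essential_of_drift (hF : F.Finite)
    (hV : ∀ x ∈ reachable P x₀, x ∉ F → mean (P x) V + 1 ≤ V x)
    (hfin : ∀ x ∈ reachable P x₀, mean (P x) V < ∞) {x : X} (hx : x ∈ reachable P x₀) :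
    ∃ y ∈ essential P x₀, Accessible P x y := by
  have hreach : ∀ y ∈ reachable P x₀, ∃ f ∈ F, Accessible P y f := fun y hy =>
    exists_accessible_of_meanHit_lt_top <|
      (meanHit_le_of_drift (reachable_closed x₀) hV y hy).trans_lt
        (ENNReal.add_lt_top.2 ⟨ENNReal.one_lt_top, hfin y hy⟩)
  -- Smaller means further along the chain. A minimal state `y` of `F` accessible from `x` is
  -- essential: whatever follows `y` leads again to some `g ∈ F`, and by minimality `g` leads back
  -- to `y`.
  let _ : Preorder X :=
    { le := fun a b => Accessible P b a
      le_refl := fun a => .refl a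
      le_trans := fun a b c hab hbc => Accessible.trans hbc hab }
  obtain ⟨f, hf, hxf⟩ := hreach x hx
  obtain ⟨y, hy⟩ := (hF.subset (Set.inter_subset_left (t := {y | Accessible P x y}))).exists_minimal
    ⟨f, hf, hxf⟩
  have hyR : y ∈ reachable P x₀ := Accessible.trans hx hy.prop.2
  refine ⟨y, ⟨hyR, fun w hw => ?_⟩, hy.prop.2⟩
  obtain ⟨g, hg, hwg⟩ := hreach w (Accessible.trans hyR hw)
  have hyg := hw.trans hwg
  exact hwg.trans (hy.le_of_le ⟨hg, hy.prop.2.trans hyg⟩ hyg)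

/-- The closed set is taken to be what is reachable from `x` itself; as `x` is essential, all states
of `F` in that set lead back to `x`. -/
theorem meanHit_self_lt_top_of_drift (hF : F.Finite)
    (hV : ∀ x ∈ reachable P x₀, x ∉ F → mean (P x) V + 1 ≤ V x)
    (hfin : ∀ x ∈ reachable P x₀, mean (P x) V < ∞) {x : X} (hx : x ∈ essential P x₀) :
    meanHit P {x} x < ∞ := by
  have hsub : ∀ y ∈ reachable P x, y ∈ reachable P x₀ := fun y hy => Accessible.trans hx.1 hy
  exact meanHit_lt_top_of_drift (reachable_closed x) hF (fun y hy => hV y (hsub y hy))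
    (fun y hy => hfin y (hsub y hy)) (fun f _ hfR => ⟨x, Set.mem_singleton x, hx.2 f hfR⟩) (.refl x)

theorem isPositiveRecurrent_of_drift (hF : F.Finite)
    (hV : ∀ x ∈ reachable P x₀, x ∉ F → mean (P x) V + 1 ≤ V x)
    (hfin : ∀ x ∈ reachable P x₀, mean (P x) V < ∞) : IsPositiveRecurrent P x₀ where
  absorbed _ hx := meanHit_lt_top_of_drift (reachable_closed x₀) hF hV hfin
    (fun _ _ hfR => exists_essential_of_drift hF hV hfin hfR) hx
  returns _ hx := meanHit_self_lt_top_of_drift hF hV hfin hx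

end Drift

/-! ### Stationary distributions -/

/-- `taboo P x n y` is the probability, for the chain started at `x`, that it is in `y` at time `n`
and has not returned to `x` at the times `1, …, n`. -/
def taboo (P : X → PMF X) (x : X) : ℕ → X → ℝ≥0∞
  | 0 => ({x} : Set X).indicator fun _ => 1
  | n + 1 => ({x}ᶜ : Set X).indicator fun y => ∑' w, taboo P x n w * P w y

/-- The mean number of visits to `y` before the first return to `x`, for the chain started at
`x`. -/
def excursion (P : X → PMF X) (x y : X) : ℝ≥0∞ := ∑' n, taboo P x n y

/-- Markov property at time `n`: no return by time `n + k` means none by time `n` and none in the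
next `k` steps. -/
theorem tsum_taboo_mul_avoid (x : X) (n k : ℕ) :
    ∑' w, taboo P x n w * avoid P {x} k w = avoid P {x} (n + k) x := by
  induction n generalizing k with
  | zero =>
    rw [tsum_eq_single x]
    · simp [taboo]
    · intro y hy
      simp [taboo, hy]
  | succ n ih =>
    rw [show n + 1 + k = n + (k + 1) by ring, ← ih (k + 1)]
    simp only [avoid_succ, mean, ← ENNReal.tsum_mul_left]
    rw [ENNReal.tsum_comm]
    refine tsum_congr fun w => ?_
    by_cases hw : w = x
    · simp [taboo, hw]
    · simp [taboo, hw, ← ENNReal.tsum_mul_right, mul_assoc]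

theorem tsum_excursion (x : X) : ∑' y, excursion P x y = meanHit P {x} x := by
  simp only [excursion]
  rw [ENNReal.tsum_comm, meanHit]
  refine tsum_congr fun n => ?_
  simpa [avoid_zero] using tsum_taboo_mul_avoid (P := P) x n 0

theorem excursion_self (x : X) : excursion P x x = 1 := by
  rw [excursion, tsum_eq_single 0]
  · simp [taboo]
  · intro n hn
    obtain ⟨n, rfl⟩ := Nat.exists_eq_succ_of_ne_zero hn
    simp [taboo]

theorem tsum_tsum_mul_apply (g : X → ℝ≥0∞) : ∑' y, ∑' w, g w * P w y = ∑' w, g w := by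
  rw [ENNReal.tsum_comm]
  simp [ENNReal.tsum_mul_left, (P _).tsum_coe]

/-- Away from `x` this is the recursion for `taboo` summed over time. At `x` it follows from
conservation of mass, the total mass being the finite mean return time. -/
theorem excursion_invariant {x : X} (h : meanHit P {x} x < ∞) (y : X) :
    ∑' w, excursion P x w * P w y = excursion P x y := by
  classical
  have hoff : ∀ y, y ≠ x → ∑' w, excursion P x w * P w y = excursion P x y := by
    intro y hy
    rw [excursion, tsum_eq_zero_add' ENNReal.summable]
    simp only [excursion, ← ENNReal.tsum_mul_right]
    rw [ENNReal.tsum_comm]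
    simp [taboo, hy]
  by_cases hy : y = x
  · subst hy
    have htot := tsum_tsum_mul_apply (P := P) (excursion P y)
    rw [ENNReal.tsum_eq_add_tsum_ite y, ENNReal.tsum_eq_add_tsum_ite (f := excursion P y) y]
      at htot
    have hrest : (∑' w, if w = y then 0 else ∑' v, excursion P y v * P v w) =
        ∑' w, if w = y then 0 else excursion P y w := by
      refine tsum_congr fun w => ?_
      split_ifs with hw
      · rfl
      · exact hoff w hw
    rw [hrest] at htot
    refine (ENNReal.add_left_inj ?_).1 htot
    refine ne_top_of_le_ne_top h.ne ?_
    rw [← tsum_excursion]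
    refine ENNReal.tsum_le_tsum fun w => ?_
    split_ifs <;> simp
  · exact hoff y hy

theorem accessible_of_taboo_pos {x y : X} {n : ℕ} (h : taboo P x n y ≠ 0) :
    Accessible P x y := by
  induction n generalizing y with
  | zero =>
    by_cases hy : y = x
    · exact hy ▸ .refl _
    · simp [taboo, hy] at h
  | succ n ih =>
    have h' : ∑' w, taboo P x n w * P w y ≠ 0 := by
      intro h0
      exact h (by simp [taboo, h0])
    simp only [ne_eq, ENNReal.tsum_eq_zero, not_forall, mul_eq_zero, not_or] at h'
    obtain ⟨w, hw, hwy⟩ := h'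
    exact (ih hw).trans (.of_pos (pos_iff_ne_zero.2 hwy))

/-- A state with a finite mean return time carries a stationary distribution. -/
theorem exists_isSteadyState {x₀ x : X} (hx : x ∈ reachable P x₀) (h : meanHit P {x} x < ∞) :
    ∃ π, IsSteadyState P x₀ π := by
  have h0 : ∑' y, excursion P x y ≠ 0 := by
    refine (lt_of_lt_of_le ?_ (ENNReal.le_tsum x)).ne'
    simp [excursion_self]
  have htop : ∑' y, excursion P x y ≠ ∞ := by rw [tsum_excursion]; exact h.ne
  refine ⟨PMF.normalize (excursion P x) h0 htop, ?_, ?_⟩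
  · ext y
    simp only [PMF.bind_apply, PMF.normalize_apply]
    rw [← excursion_invariant h y, ← ENNReal.tsum_mul_right]
    exact tsum_congr fun w => mul_right_comm _ _ _
  · intro y hy
    rw [PMF.mem_support_normalize_iff] at hy
    simp only [excursion, ne_eq, ENNReal.tsum_eq_zero, not_forall] at hy
    obtain ⟨n, hn⟩ := hy
    exact Accessible.trans hx (accessible_of_taboo_pos hn)

theorem tsum_mul_apply_of_bind_eq {π : PMF X} (hπ : π.bind P = π) (y : X) :
    ∑' w, π w * P w y = π y := by
  rw [← PMF.bind_apply, hπ]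

/-- Decomposition at the last visit to `x`: the summands correspond to the disjoint events that `x`
was last visited `k` steps ago. -/
theorem mul_sum_taboo_le {π : PMF X} (hπ : π.bind P = π) (x : X) (n : ℕ) (y : X) :
    π x * ∑ k ∈ Finset.range n, taboo P x k y ≤ π y := by
  induction n generalizing y with
  | zero => simp
  | succ n ih =>
    rw [Finset.sum_range_succ']
    by_cases hy : y = x
    · subst hy
      simp [taboo]
    · simp only [taboo, Set.mem_compl_iff, Set.mem_singleton_iff, hy, not_false_eq_true,
        Set.indicator_of_mem, Set.indicator_of_notMem, add_zero]
      rw [← tsum_mul_apply_of_bind_eq hπ y,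
        ← Summable.tsum_finsetSum fun _ _ => ENNReal.summable, ← ENNReal.tsum_mul_left]
      refine ENNReal.tsum_le_tsum fun w => ?_
      rw [← Finset.sum_mul, ← mul_assoc]
      exact mul_le_mul_left (ih w) _

theorem mul_excursion_le {π : PMF X} (hπ : π.bind P = π) (x y : X) :
    π x * excursion P x y ≤ π y := by
  rw [excursion, ENNReal.tsum_eq_iSup_nat, ENNReal.mul_iSup]
  exact iSup_le fun n => mul_sum_taboo_le hπ x n y

/-- A stationary distribution is a multiple of the excursion measure of `x` on the states from
which `x` can be reached. -/
theorem apply_eq_mul_excursion {π : PMF X} (hπ : π.bind P = π) {x : X}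
    (h : meanHit P {x} x < ∞) {y : X} (hy : Accessible P y x) :
    π y = π x * excursion P x y := by
  induction hy using Relation.ReflTransGen.head_induction_on with
  | refl => rw [excursion_self, mul_one]
  | @head w v hwv _ ih =>
    refine le_antisymm ?_ (mul_excursion_le hπ x w)
    -- A strict inequality at `w` would pass along the transition `w → v` into the balance equation
    -- at `v`, where equality is already known.
    by_contra! hlt
    have hsum : ∑' u, π x * excursion P x u * P u v = π v := by
      simp only [mul_assoc, ENNReal.tsum_mul_left]
      rw [excursion_invariant h, ih]
    have hlt' : ∑' u, π x * excursion P x u * P u v < ∑' u, π u * P u v := by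
      refine ENNReal.tsum_lt_tsum (i := w) ?_ (fun u => ?_) ?_
      · rw [hsum]
        exact PMF.apply_ne_top π v
      · exact mul_le_mul_left (mul_excursion_le hπ x u) _
      · exact (ENNReal.mul_lt_mul_iff_left hwv.ne' (PMF.apply_ne_top _ _)).2 hlt
    rw [hsum, tsum_mul_apply_of_bind_eq hπ] at hlt'
    exact lt_irrefl _ hlt'

/-- Both laws are multiples of the excursion measure of `x`, and both have mass one;
cross-multiplying avoids division. -/
theorem IsSteadyState.eq_of_accessible {x₀ x : X} {π π' : PMF X} (hπ : IsSteadyState P x₀ π)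
    (hπ' : IsSteadyState P x₀ π') (hacc : ∀ y ∈ reachable P x₀, Accessible P y x)
    (h : meanHit P {x} x < ∞) : π = π' := by
  have hex : ∀ ρ : PMF X, IsSteadyState P x₀ ρ → ∀ y ∈ reachable P x₀,
      ρ y = ρ x * excursion P x y := fun ρ hρ y hy => apply_eq_mul_excursion hρ.1 h (hacc y hy)
  have hout : ∀ ρ : PMF X, IsSteadyState P x₀ ρ → ∀ y ∉ reachable P x₀, ρ y = 0 :=
    fun ρ hρ y hy => (ρ.apply_eq_zero_iff y).2 fun hs => hy (hρ.2 hs)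
  have hcross : ∀ y, π y * π' x = π' y * π x := by
    intro y
    by_cases hy : y ∈ reachable P x₀
    · rw [hex π hπ y hy, hex π' hπ' y hy]
      ring
    · rw [hout π hπ y hy, hout π' hπ' y hy]
      ring
  have hx : π' x = π x := by
    have : ∑' y, π y * π' x = ∑' y, π' y * π x := tsum_congr hcross
    simpa [ENNReal.tsum_mul_right, PMF.tsum_coe] using this
  ext y
  by_cases hy : y ∈ reachable P x₀
  · rw [hex π hπ y hy, hex π' hπ' y hy, hx]
  · rw [hout π hπ y hy, hout π' hπ' y hy]

/-! ### Moments under a stationary distribution -/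

/-- The expectation of `φ` at time `n`, as a function of the initial state. -/
def meanAt (P : X → PMF X) (φ : X → ℝ≥0∞) : ℕ → X → ℝ≥0∞
  | 0, x => φ x
  | n + 1, x => mean (P x) (meanAt P φ n)

theorem mean_meanAt {π : PMF X} (hπ : π.bind P = π) (φ : X → ℝ≥0∞) (n : ℕ) :
    mean π (meanAt P φ n) = mean π φ := by
  induction n with
  | zero => rfl
  | succ n ih =>
    rw [← ih]
    conv_rhs => rw [← hπ, mean_bind]
    rfl

theorem sum_meanAt_succ (φ : X → ℝ≥0∞) (n : ℕ) (x : X) :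
    ∑ k ∈ Finset.range (n + 1), meanAt P φ k x =
      mean (P x) (fun y => ∑ k ∈ Finset.range n, meanAt P φ k y) + φ x := by
  rw [Finset.sum_range_succ', mean_sum]
  rfl

/-- The drift inequality telescoped over `n` steps: `V` at the start pays for the accumulated `f`,
up to `C` per step. -/
theorem sum_meanAt_le {R : Set X} (hR : ∀ x ∈ R, ∀ y, 0 < P x y → y ∈ R)
    {V f : X → ℝ≥0∞} {C : ℝ≥0∞} (hV : ∀ x ∈ R, mean (P x) V + f x ≤ V x + C) (n : ℕ) :
    ∀ x ∈ R, ∑ k ∈ Finset.range n, meanAt P f k x ≤ V x + n * C := by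
  induction n with
  | zero => simp
  | succ n ih =>
    intro x hx
    rw [sum_meanAt_succ]
    calc _ ≤ mean (P x) (fun y => V y + n * C) + f x := by
          gcongr
          exact mean_mono_of_pos fun y hy => ih y (hR x hx y hy)
      _ = mean (P x) V + f x + n * C := by
          rw [mean_add, mean_const, add_right_comm]
      _ ≤ V x + C + n * C := by
          gcongr ?_ + _
          exact hV x hx
      _ = V x + (n + 1 : ℕ) * C := by
          push_cast
          ring

theorem sum_meanAt_le_mul {φ : X → ℝ≥0∞} {K : ℝ≥0∞} (hφ : ∀ x, φ x ≤ K) (n : ℕ) (x : X) :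
    ∑ k ∈ Finset.range n, meanAt P φ k x ≤ n * K := by
  induction n generalizing x with
  | zero => simp
  | succ n ih =>
    rw [sum_meanAt_succ]
    calc _ ≤ mean (P x) (fun _ => n * K) + K := add_le_add (mean_mono ih) (hφ x)
      _ = _ := by
        rw [mean_const]
        push_cast
        ring

/-- The contribution of the initial state to an `n`-step average vanishes; the constant `K` serves
as dominating function, so `V` need not be integrable. -/
theorem tendsto_mean_min_div (π : PMF X) {V : X → ℝ≥0∞} (hV : ∀ x, V x ≠ ∞) {K : ℝ≥0∞}
    (hK : K ≠ ∞) :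
    Filter.Tendsto (fun n : ℕ => mean π fun x => min K (V x / n)) Filter.atTop (nhds 0) := by
  let _ : MeasurableSpace X := ⊤
  have key := MeasureTheory.tendsto_lintegral_of_dominated_convergence
    (μ := MeasureTheory.Measure.count) (F := fun n : ℕ => fun x => π x * min K (V x / n))
    (f := fun _ => 0) (fun x => π x * K) (fun _ => measurable_from_top)
    (fun n => Filter.Eventually.of_forall fun x => mul_le_mul_right (min_le_left _ _) _)
    (by
      rw [MeasureTheory.lintegral_count, ENNReal.tsum_mul_right, π.tsum_coe, one_mul]
      exact hK)
    (Filter.Eventually.of_forall fun x => by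
      have h1 : Filter.Tendsto (fun n : ℕ => V x / n) Filter.atTop (nhds 0) :=
        ENNReal.Tendsto.const_div ENNReal.tendsto_nat_nhds_top (Or.inr (hV x)) |>.trans_eq (by simp)
      have h2 : Filter.Tendsto (fun n : ℕ => min K (V x / n)) Filter.atTop (nhds 0) :=
        tendsto_of_tendsto_of_tendsto_of_le_of_le tendsto_const_nhds h1 (fun _ => zero_le)
          fun _ => min_le_right _ _
      simpa using ENNReal.Tendsto.const_mul h2 (Or.inr (PMF.apply_ne_top π x)))
  simpa [MeasureTheory.lintegral_count, mean] using key

/-- If `V` has drift at most `C - f`, then `f` has mean at most `C` under every stationary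
distribution, whether or not `V` is integrable. -/
theorem mean_le_of_drift {R : Set X} (hR : ∀ x ∈ R, ∀ y, 0 < P x y → y ∈ R)
    {V f : X → ℝ≥0∞} {C : ℝ≥0∞} (hVtop : ∀ x, V x ≠ ∞) (hf : ∀ x, f x ≠ ∞)
    (hV : ∀ x ∈ R, mean (P x) V + f x ≤ V x + C) {π : PMF X} (hπ : π.bind P = π)
    (hsupp : π.support ⊆ R) : mean π f ≤ C := by
  have htrunc : ∀ K : ℝ≥0∞, K ≠ ∞ → mean π (fun x => min (f x) K) ≤ C := by
    intro K hK
    -- By stationarity, `n` times the mean is the mean of the sum over `n` steps. From each `x` that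
    -- sum is at most `n * K` and at most `V x + n * C`; the smaller bound is used.
    have hn : ∀ n : ℕ, 0 < n →
        mean π (fun x => min (f x) K) ≤ C + mean π fun x => min K (V x / n) := by
      intro n hn
      have hn0 : (n : ℝ≥0∞) ≠ 0 := by exact_mod_cast hn.ne'
      have hntop : (n : ℝ≥0∞) ≠ ∞ := ENNReal.natCast_ne_top n
      have hsum : n * mean π (fun x => min (f x) K) =
          mean π fun x => ∑ k ∈ Finset.range n, meanAt P (fun x => min (f x) K) k x := by
        rw [mean_sum, Finset.sum_congr rfl fun k _ => mean_meanAt hπ _ k]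
        simp
      have hle : n * mean π (fun x => min (f x) K) ≤
          n * (C + mean π fun x => min K (V x / n)) := by
        rw [hsum]
        rw [← mean_const π C, ← mean_add, ← mean_const_mul]
        refine mean_mono_of_pos fun x hx => ?_
        have hxR : x ∈ R := hsupp ((π.mem_support_iff x).2 hx.ne')
        have hb₁ := sum_meanAt_le_mul (P := P) (φ := fun x => min (f x) K)
          (fun x => min_le_right _ _) n x
        have hb₂ := sum_meanAt_le hR (V := V) (f := fun x => min (f x) K) (C := C)
          (fun y hy => (add_le_add_right (min_le_left _ _) _).trans (hV y hy)) n x hxR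
        rw [mul_add]
        rcases min_cases K (V x / n) with ⟨hm, -⟩ | ⟨hm, -⟩
        · rw [hm]
          exact hb₁.trans le_add_self
        · rw [hm, ENNReal.mul_div_cancel hn0 hntop, add_comm]
          exact hb₂
      exact (ENNReal.mul_le_mul_iff_right hn0 hntop).1 hle
    have hlim := (tendsto_mean_min_div π hVtop hK).const_add C
    rw [add_zero] at hlim
    exact ge_of_tendsto hlim (Filter.eventually_atTop.2 ⟨1, fun n h => hn n h⟩)
  rw [mean, ENNReal.tsum_eq_iSup_sum]
  refine iSup_le fun s => ?_
  -- On the finite set `s` the function `f` is below its own sum over `s`, so truncation at that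
  -- level changes nothing there.
  refine le_trans ?_ (htrunc (∑ x ∈ s, f x) (ENNReal.sum_ne_top.2 fun x _ => hf x))
  refine le_trans (Finset.sum_le_sum fun x hx => ?_) (ENNReal.sum_le_tsum s)
  beta_reduce
  rw [min_eq_left (Finset.single_le_sum (f := f) (fun _ _ => zero_le) hx)]

end MarkovChain


/-! ### Elementary inequalities -/

namespace LED

section Inequalities

/-- Convexity: the tangent at `y` lies below the power. The induction step leaves the remainder `(n
+ 1) * y ^ n * (x - y) ^ 2`. -/
theorem pow_succ_add_tangent_le {x y : ℝ} (hx : 0 ≤ x) (hy : 0 ≤ y) (n : ℕ) :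
    y ^ (n + 1) + (n + 1) * y ^ n * (x - y) ≤ x ^ (n + 1) := by
  induction n with
  | zero => simp
  | succ n ih =>
    have h₁ := mul_le_mul_of_nonneg_left ih hx
    have h₂ : 0 ≤ (n + 1) * y ^ n * (x - y) ^ 2 := by positivity
    push_cast
    calc _ = x * (y ^ (n + 1) + (n + 1) * y ^ n * (x - y)) - (n + 1) * y ^ n * (x - y) ^ 2 := by
          ring
      _ ≤ x ^ (n + 1 + 1) := by
          rw [pow_succ' x (n + 1)]
          linarith

theorem abs_pow_succ_sub_pow_succ_le {x y d : ℝ} (hx : 0 ≤ x) (hy : 0 ≤ y) (h : |y - x| ≤ d)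
    (n : ℕ) : |y ^ (n + 1) - x ^ (n + 1)| ≤ (n + 1) * (d * (x + d) ^ n) := by
  have hd : 0 ≤ d := (abs_nonneg _).trans h
  have hyx : y ≤ x + d := by linarith [(abs_le.1 h).2]
  have hmax : max |y| |x| ≤ x + d := by
    rw [abs_of_nonneg hx, abs_of_nonneg hy]
    exact max_le hyx (by linarith)
  calc _ ≤ |y - x| * ((n + 1 : ℕ) : ℝ) * max |y| |x| ^ n := by
        simpa using abs_pow_sub_pow_le y x (n + 1)
    _ ≤ d * ((n + 1 : ℕ) : ℝ) * (x + d) ^ n := by gcongr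
    _ = _ := by
        push_cast
        ring

/-- Separates the current state `x` from the random increment `d`, so that expectations over a slot
factor. -/
theorem mul_add_pow_le_mul_pow {x d : ℝ} (hx : 0 ≤ x) (hd : 0 ≤ d) (n : ℕ) :
    d * (x + d) ^ n ≤ (1 + d) ^ (n + 1) * (1 + x) ^ n := by
  have h : x + d ≤ (1 + d) * (1 + x) := by nlinarith
  calc _ ≤ (1 + d) * ((1 + d) * (1 + x)) ^ n := by
        gcongr
        linarith
    _ = _ := by
        rw [mul_pow]
        ring

/-- One step of a queue: the increment of a power of its length. -/
theorem queue_pow_le {x a s B : ℕ} (hB : a + s ≤ B) (k : ℕ) :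
    (x + a - s) ^ (k + 2) + (k + 2) * x ^ (k + 1) * s ≤
      x ^ (k + 2) + (k + 2) * x ^ (k + 1) * a +
        (k + 2) * (k + 1) * ((1 + x) ^ k * (1 + B) ^ (k + 2)) := by
  obtain ⟨y, hy⟩ : ∃ y, y = x + a - s := ⟨_, rfl⟩
  rw [← hy]
  have hBR : (a : ℝ) + s ≤ B := by exact_mod_cast hB
  have hx : (0 : ℝ) ≤ x := x.cast_nonneg
  have ha : (0 : ℝ) ≤ a := a.cast_nonneg
  have hs : (0 : ℝ) ≤ s := s.cast_nonneg
  have hy0 : (0 : ℝ) ≤ y := y.cast_nonneg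
  have hB0 : (0 : ℝ) ≤ B := B.cast_nonneg
  have hcases : y = 0 ∨ (y : ℝ) - x = a - s := by
    rcases Nat.eq_zero_or_pos y with h | h
    · exact Or.inl h
    · right
      have : y + s = x + a := by omega
      have : (y : ℝ) + s = x + a := by exact_mod_cast this
      linarith
  have hyx : |(y : ℝ) - x| ≤ B := by
    have h₁ : y ≤ x + B := by omega
    have h₂ : x ≤ y + B := by omega
    have h₁' : (y : ℝ) ≤ x + B := by exact_mod_cast h₁
    have h₂' : (x : ℝ) ≤ y + B := by exact_mod_cast h₂
    exact abs_le.2 ⟨by linarith, by linarith⟩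
  -- The tangent is taken at the new length `y`: truncation at `0` occurs only if `y = 0`, where the
  -- factor `y ^ (k + 1)` vanishes, so `y - x` may be replaced by `a - s` exactly. Returning from `y
  -- ^ (k + 1)` to `x ^ (k + 1)` costs a term of lower order in `x`.
  have htan := pow_succ_add_tangent_le hx hy0 (k + 1)
  have hmul : (y : ℝ) ^ (k + 1) * (y - x) = y ^ (k + 1) * (a - s) := by
    rcases hcases with h | h
    · simp [h]
    · rw [h]
  have hdiff := abs_pow_succ_sub_pow_succ_le hx hy0 hyx k
  have habs : |(a : ℝ) - s| ≤ 1 + B := abs_le.2 ⟨by linarith, by linarith⟩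
  have herr : ((y : ℝ) ^ (k + 1) - x ^ (k + 1)) * (a - s) ≤
      (k + 1) * ((1 + x) ^ k * (1 + B) ^ (k + 2)) := by
    calc _ ≤ |(y : ℝ) ^ (k + 1) - x ^ (k + 1)| * |(a : ℝ) - s| := by
          rw [← abs_mul]
          exact le_abs_self _
      _ ≤ ((k + 1) * ((1 + B) ^ (k + 1) * (1 + x) ^ k)) * (1 + B) := by
          refine mul_le_mul (hdiff.trans ?_) habs (abs_nonneg _) (by positivity)
          gcongr ?_ * ?_
          exact mul_add_pow_le_mul_pow hx hB0 k
      _ = _ := by ring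
  have hreal : (y : ℝ) ^ (k + 2) + (k + 2) * x ^ (k + 1) * s ≤
      x ^ (k + 2) + (k + 2) * x ^ (k + 1) * a +
        (k + 2) * (k + 1) * ((1 + x) ^ k * (1 + B) ^ (k + 2)) := by
    have h₁ : (y : ℝ) ^ (k + 2) ≤ x ^ (k + 2) + (k + 2) * (y ^ (k + 1) * (a - s)) := by
      rw [← hmul]
      push_cast at htan
      linarith
    have h₂ := mul_le_mul_of_nonneg_left herr (by positivity : (0 : ℝ) ≤ k + 2)
    linarith
  exact_mod_cast hreal

theorem gap_pow_le {d d' B : ℕ} (h : d' ≤ d + B) (k : ℕ) :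
    d' ^ (k + 1) ≤ d ^ (k + 1) + (k + 1) * ((1 + d) ^ k * (1 + B) ^ (k + 1)) := by
  refine (Nat.pow_le_pow_left h (k + 1)).trans ?_
  have hd : (0 : ℝ) ≤ d := d.cast_nonneg
  have hB : (0 : ℝ) ≤ B := B.cast_nonneg
  have h₁ := (le_abs_self _).trans (abs_pow_succ_sub_pow_succ_le hd (add_nonneg hd hB)
    (by rw [add_sub_cancel_left, abs_of_nonneg hB] : |(d : ℝ) + B - d| ≤ B) k)
  have h₂ := mul_le_mul_of_nonneg_left (mul_add_pow_le_mul_pow hd hB k)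
    (by positivity : (0 : ℝ) ≤ k + 1)
  have hreal : ((d : ℝ) + B) ^ (k + 1) ≤
      d ^ (k + 1) + (k + 1) * ((1 + d) ^ k * (1 + B) ^ (k + 1)) := by
    rw [mul_comm ((1 + d : ℝ) ^ k)]
    linarith
  exact_mod_cast hreal

/-- A weighted Young inequality. -/
theorem exists_mul_add_pow_le (k : ℕ) {η : ℝ} (hη : 0 < η) :
    ∃ K : ℝ, 0 ≤ K ∧ ∀ x d : ℝ, 0 ≤ x → 0 ≤ d →
      d * (x + d) ^ k ≤ η * x ^ (k + 1) + K * d ^ (k + 1) := by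
  -- If `d ≤ δ * x`, then `d ≤ x` and the left side is at most `δ * 2 ^ k * x ^ (k + 1)`. Otherwise
  -- `x ≤ d / δ`, and a power of `d` dominates.
  set δ : ℝ := min 1 (η / 2 ^ k)
  have hδ : 0 < δ := by positivity
  have hδ1 : δ ≤ 1 := min_le_left _ _
  have hδη : δ * 2 ^ k ≤ η := by
    rw [← le_div_iff₀ (by positivity)]
    exact min_le_right _ _
  refine ⟨(1 / δ + 1) ^ k, by positivity, fun x d hx hd => ?_⟩
  rcases le_total d (δ * x) with h | h
  · have hdx : d ≤ x := h.trans (mul_le_of_le_one_left hx hδ1)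
    calc d * (x + d) ^ k ≤ δ * x * (2 * x) ^ k := by
          gcongr
          linarith
      _ = δ * 2 ^ k * x ^ (k + 1) := by
          rw [mul_pow]
          ring
      _ ≤ η * x ^ (k + 1) := by gcongr
      _ ≤ _ := le_add_of_nonneg_right (by positivity)
  · have hxd : x ≤ 1 / δ * d := by
      rw [one_div, ← div_eq_inv_mul, le_div_iff₀ hδ]
      linarith
    calc d * (x + d) ^ k ≤ d * ((1 / δ + 1) * d) ^ k := by
          gcongr
          linarith
      _ = (1 / δ + 1) ^ k * d ^ (k + 1) := by
          rw [mul_pow]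
          ring
      _ ≤ _ := le_add_of_nonneg_left (by positivity)

/-- Each of the `s.card + 1` summands is at most their maximum, whose `k`-th power is one of the
summands on the right. -/
theorem one_add_sum_pow_le {ι : Type*} (s : Finset ι) (x : ι → ℕ) (k : ℕ) :
    (1 + ∑ i ∈ s, x i) ^ k ≤ (s.card + 1) ^ k * (1 + ∑ i ∈ s, x i ^ k) := by
  obtain ⟨y, hy⟩ : ∃ y, y = max 1 (s.sup x) := ⟨_, rfl⟩
  have hsum : 1 + ∑ i ∈ s, x i ≤ (s.card + 1) * y := by
    have h : ∑ i ∈ s, x i ≤ s.card • y :=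
      Finset.sum_le_card_nsmul _ _ _ fun i hi => by
        rw [hy]
        exact (Finset.le_sup hi).trans (le_max_right _ _)
    have h1 : 1 ≤ y := by
      rw [hy]
      exact le_max_left _ _
    rw [smul_eq_mul] at h
    rw [add_mul, one_mul, add_comm]
    exact add_le_add h h1
  have hyk : y ^ k ≤ 1 + ∑ i ∈ s, x i ^ k := by
    rcases le_total (s.sup x) 1 with h | h
    · rw [hy, max_eq_left h, one_pow]
      exact Nat.le_add_right _ _
    · have hne : s.Nonempty := by
        by_contra hs
        rw [Finset.not_nonempty_iff_eq_empty] at hs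
        simp [hs] at h
      obtain ⟨i, hi, hix⟩ := Finset.exists_mem_eq_sup s hne x
      rw [hy, max_eq_right h, hix]
      exact (Finset.single_le_sum (f := fun i => x i ^ k) (fun _ _ => Nat.zero_le _) hi).trans
        (Nat.le_add_left _ _)
  calc _ ≤ ((s.card + 1) * y) ^ k := Nat.pow_le_pow_left hsum k
    _ = (s.card + 1) ^ k * y ^ k := mul_pow _ _ _
    _ ≤ _ := Nat.mul_le_mul_left _ hyk

end Inequalities

/-! ### Tilted dispatching -/

section Tilted

variable {N : ℕ}

/-- A tilted strategy prefers small values of any increasing function of the estimates. -/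
theorem IsTilted.sum_le_zero {μ : Fin N → ℝ} (hμ : ∑ n, μ n ≠ 0)
    {d : (Fin N → ℕ) → PMF (Fin N)} (h : IsTilted μ d) (q : Fin N → ℕ) {g : ℕ → ℝ}
    (hg : Monotone g) : ∑ n, g (q n) * ((d q n).toReal - μ n / ∑ j, μ j) ≤ 0 := by
  obtain ⟨σ, hσ, k, -, hlow, hhigh⟩ := h q
  have hone : ∑ n, (d q n).toReal = 1 := by
    rw [← ENNReal.toReal_sum fun n _ => PMF.apply_ne_top _ _, ← tsum_fintype (L := .unconditional _),
      PMF.tsum_coe, ENNReal.toReal_one]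
  have hzero : ∑ i, preference μ (d q) σ i = 0 := by
    unfold preference
    rw [Equiv.sum_comp σ fun n => (d q n).toReal - μ n / ∑ j, μ j, Finset.sum_sub_distrib, hone,
      ← Finset.sum_div, div_self hμ, sub_self]
  rw [← Equiv.sum_comp σ]
  calc _ = ∑ i, g (q (σ i)) * preference μ (d q) σ i := rfl
    -- Before position `k`, `g` is at most its value at the pivot and the preference is nonnegative;
    -- from `k` on both signs are reversed. With `g` frozen at the pivot the sum vanishes, as
    -- preferences sum to zero.
    _ ≤ ∑ i, g (q (σ k)) * preference μ (d q) σ i := by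
        refine Finset.sum_le_sum fun i _ => ?_
        rcases lt_or_ge i k with hi | hi
        · exact mul_le_mul_of_nonneg_right (hg (hσ hi.le)) (hlow i hi)
        · exact mul_le_mul_of_nonpos_right (hg (hσ hi)) (hhigh i hi)
    _ = 0 := by rw [← Finset.mul_sum, hzero, mul_zero]

theorem abs_toReal_sub_div_sum_le_one {μ : Fin N → ℝ} (hμ : ∀ n, 0 < μ n) (d : PMF (Fin N))
    (n : Fin N) : |(d n).toReal - μ n / ∑ j, μ j| ≤ 1 := by
  have h₁ : (d n).toReal ≤ 1 :=
    ENNReal.toReal_le_of_le_ofReal zero_le_one (by simpa using d.coe_le_one n)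
  have h₂ : μ n / ∑ j, μ j ≤ 1 := by
    refine div_le_one_of_le₀ ?_ (Finset.sum_nonneg fun j _ => (hμ j).le)
    exact Finset.single_le_sum (fun j _ => (hμ j).le) (Finset.mem_univ n)
  have h₃ : 0 ≤ μ n / ∑ j, μ j := div_nonneg (hμ n).le (Finset.sum_nonneg fun j _ => (hμ j).le)
  exact abs_le.2 ⟨by linarith [ENNReal.toReal_nonneg (a := d n)], by linarith⟩

/-- The tilt is a statement about the estimates `e`. Passing to the powers of `q` costs their
differences, because each preference is at most `1` in absolute value. -/
theorem IsTilted.sum_pow_le {μ : Fin N → ℝ} (hμ : ∀ n, 0 < μ n) {d : (Fin N → ℕ) → PMF (Fin N)}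
    (h : IsTilted μ d) (q e : Fin N → ℕ) (k : ℕ) :
    ∑ n, (q n : ℝ) ^ (k + 1) * ((d e n).toReal - μ n / ∑ j, μ j) ≤
      ∑ n, (k + 1) * ((Nat.dist (q n) (e n) : ℝ) * (q n + Nat.dist (q n) (e n)) ^ k) := by
  rcases isEmpty_or_nonempty (Fin N) with hN | hN
  · simp
  have hpos : ∑ n, μ n ≠ 0 := (Finset.sum_pos (fun n _ => hμ n) Finset.univ_nonempty).ne'
  have htilt := h.sum_le_zero hpos e (g := fun x => (x : ℝ) ^ (k + 1))
    (fun a b hab => by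
      have : (a : ℝ) ≤ b := by exact_mod_cast hab
      dsimp only
      gcongr)
  have hterm : ∀ n, (q n : ℝ) ^ (k + 1) * ((d e n).toReal - μ n / ∑ j, μ j) ≤
      (e n : ℝ) ^ (k + 1) * ((d e n).toReal - μ n / ∑ j, μ j) +
        (k + 1) * ((Nat.dist (q n) (e n) : ℝ) * (q n + Nat.dist (q n) (e n)) ^ k) := by
    intro n
    have hdist : |(e n : ℝ) - q n| ≤ (Nat.dist (q n) (e n) : ℝ) := by
      have h₁ : e n ≤ q n + Nat.dist (q n) (e n) := by unfold Nat.dist; omega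
      have h₂ : q n ≤ e n + Nat.dist (q n) (e n) := by unfold Nat.dist; omega
      have h₁' : (e n : ℝ) ≤ q n + Nat.dist (q n) (e n) := by exact_mod_cast h₁
      have h₂' : (q n : ℝ) ≤ e n + Nat.dist (q n) (e n) := by exact_mod_cast h₂
      exact abs_le.2 ⟨by linarith, by linarith⟩
    have hpow := abs_pow_succ_sub_pow_succ_le (q n).cast_nonneg (e n).cast_nonneg hdist k
    have hprod : ((q n : ℝ) ^ (k + 1) - (e n : ℝ) ^ (k + 1)) *
        ((d e n).toReal - μ n / ∑ j, μ j) ≤ |(e n : ℝ) ^ (k + 1) - (q n : ℝ) ^ (k + 1)| * 1 := by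
      refine (le_abs_self _).trans ?_
      rw [abs_mul, abs_sub_comm]
      exact mul_le_mul_of_nonneg_left (abs_toReal_sub_div_sum_le_one hμ (d e) n) (abs_nonneg _)
    linarith
  calc _ ≤ _ := Finset.sum_le_sum fun n _ => hterm n
    _ ≤ _ := by
      rw [Finset.sum_add_distrib]
      linarith

end Tilted

end LED


namespace LED

open MarkovChain

variable {M N : ℕ}

/-! ### Expectations over one slot -/

theorem mean_eq_lintegral {β : Type*} [Countable β] [MeasurableSpace β]
    [MeasurableSingletonClass β] (p : PMF β) (g : β → ℝ≥0∞) :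
    mean p g = ∫⁻ x, g x ∂p.toMeasure := by
  rw [MeasureTheory.lintegral_countable', mean]
  refine tsum_congr fun x => ?_
  rw [PMF.toMeasure_apply_singleton _ _ (measurableSet_singleton x), mul_comm]

theorem mean_indep_eval {k : ℕ} {β : Type} [Countable β] [MeasurableSpace β]
    [MeasurableSingletonClass β] (p : Fin k → PMF β) (i : Fin k) (g : β → ℝ≥0∞) :
    mean (indep p) (fun f => g (f i)) = mean (p i) g := by
  rw [mean_eq_lintegral, mean_eq_lintegral, indep, MeasureTheory.Measure.toPMF_toMeasure]
  exact (MeasureTheory.measurePreserving_eval (fun i => (p i).toMeasure) i).lintegral_comp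
    (measurable_of_countable g)

section Slot

variable (arr : PMF (Fin M → ℕ)) (svc : Fin N → PMF ℕ) (pol : Policy M N) (z : State M N)

theorem mean_slot (f : Slot M N → ℝ≥0∞) : mean (slot arr svc pol z) f =
    mean arr fun a => mean (indep fun m => pol.dispatch m (z.2 m)) fun c =>
      mean (indep svc) fun s => mean (pol.update z a c s) fun u => f ⟨a, c, s, u⟩ := by
  simp only [slot, mean_bind, mean_map]

theorem mean_slot_arrivals (g : (Fin M → ℕ) → ℝ≥0∞) :
    mean (slot arr svc pol z) (fun w => g w.arrivals) = mean arr g := by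
  simp only [mean_slot, mean_const]

theorem mean_slot_service (n : Fin N) (g : ℕ → ℝ≥0∞) :
    mean (slot arr svc pol z) (fun w => g (w.service n)) = mean (svc n) g := by
  simp only [mean_slot, mean_const, mean_indep_eval]

theorem mean_slot_routed (m : Fin M) (n : Fin N) :
    mean (slot arr svc pol z) (fun w => (w.routed m n : ℝ≥0∞)) =
      mean arr (fun a => (a m : ℝ≥0∞)) * pol.dispatch m (z.2 m) n := by
  simp only [mean_slot, mean_const, Slot.routed]
  rw [← mean_mul_const]
  congr 1
  funext a
  rw [mean_indep_eval (fun m => pol.dispatch m (z.2 m)) m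
    (fun j => ((if j = n then a m else 0 : ℕ) : ℝ≥0∞)), mean, tsum_eq_single n]
  · simp [mul_comm]
  · intro j hj
    simp [hj]

/-- The total number of tasks that arrive and of services that are offered in a slot. -/
def Slot.load (w : Slot M N) : ℕ := ∑ m, w.arrivals m + ∑ n, w.service n

theorem Slot.sum_routed_add_service_le_load (w : Slot M N) (n : Fin N) :
    ∑ m, w.routed m n + w.service n ≤ w.load := by
  refine add_le_add (Finset.sum_le_sum fun m _ => ?_)
    (Finset.single_le_sum (f := w.service) (fun _ _ => Nat.zero_le _) (Finset.mem_univ n))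
  unfold Slot.routed
  split_ifs <;> simp

theorem Slot.dist_nextEstimate_le (w : Slot M N) (m : Fin M) (n : Fin N) :
    Nat.dist (w.nextQueue z.1 n) (w.nextEstimate z m n) ≤ Nat.dist (z.1 n) (z.2 m n) + w.load := by
  have h₁ := w.sum_routed_add_service_le_load n
  have h₂ : w.routed m n ≤ ∑ m, w.routed m n :=
    Finset.single_le_sum (f := fun m => w.routed m n) (fun _ _ => Nat.zero_le _)
      (Finset.mem_univ m)
  unfold Slot.nextEstimate Slot.nextQueue Nat.dist
  split <;> omega

theorem Slot.dist_nextEstimate_of_refresh (w : Slot M N) {m : Fin M} {n : Fin N}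
    (h : w.action m n = Action.refresh) :
    Nat.dist (w.nextQueue z.1 n) (w.nextEstimate z m n) = 0 := by
  simp [Slot.nextEstimate, h, Nat.dist_self]

end Slot

/-! ### Moments of arrivals and services -/

theorem natCast_pow_le_exp {θ : ℝ} (hθ : 0 < θ) (k t : ℕ) :
    ((t ^ k : ℕ) : ℝ≥0∞) ≤
      ENNReal.ofReal (k.factorial / θ ^ k) * ENNReal.ofReal (Real.exp (θ * t)) := by
  rw [← ENNReal.ofReal_mul (by positivity), ← ENNReal.ofReal_natCast]
  refine ENNReal.ofReal_le_ofReal ?_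
  have h := Real.pow_div_factorial_le_exp (θ * t) (by positivity) k
  rw [mul_pow, div_le_iff₀ (by positivity)] at h
  rw [div_mul_eq_mul_div, le_div_iff₀ (by positivity)]
  push_cast
  linarith

theorem ArrivalAssumptions.mean_pow_lt_top {arr : PMF (Fin M → ℕ)} (h : ArrivalAssumptions arr)
    (m : Fin M) (k : ℕ) : mean arr (fun a => ((a m ^ k : ℕ) : ℝ≥0∞)) < ∞ := by
  obtain ⟨θ, hθ, hfin⟩ := h.light_tail
  refine lt_of_le_of_lt (mean_mono fun a => ?_) (?_ : mean arr (fun a =>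
    ENNReal.ofReal (k.factorial / θ ^ k) * ENNReal.ofReal (Real.exp (θ * ∑ m, (a m : ℝ)))) < ∞)
  · refine le_trans ?_ ((natCast_pow_le_exp hθ k (∑ m, a m)).trans_eq (by push_cast; rfl))
    exact_mod_cast Nat.pow_le_pow_left
      (Finset.single_le_sum (f := a) (fun _ _ => Nat.zero_le _) (Finset.mem_univ m)) k
  · rw [mean_const_mul]
    exact ENNReal.mul_lt_top ENNReal.ofReal_lt_top hfin

theorem ServiceAssumptions.mean_pow_lt_top {svc : Fin N → PMF ℕ} (h : ServiceAssumptions svc)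
    (n : Fin N) (k : ℕ) : mean (svc n) (fun s => ((s ^ k : ℕ) : ℝ≥0∞)) < ∞ := by
  obtain ⟨θ, hθ, hfin⟩ := h.light_tail
  refine lt_of_le_of_lt (mean_mono fun s => natCast_pow_le_exp hθ k s) ?_
  rw [mean_const_mul]
  exact ENNReal.mul_lt_top ENNReal.ofReal_lt_top (hfin n)

/-- The bound is uniform in `z` because the laws of arrivals and services do not depend on the
state. -/
theorem exists_mean_load_pow_le {arr : PMF (Fin M → ℕ)} (harr : ArrivalAssumptions arr)
    {svc : Fin N → PMF ℕ} (hsvc : ServiceAssumptions svc) (pol : Policy M N) (k : ℕ) :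
    ∃ C : ℝ, 0 ≤ C ∧ ∀ z, mean (slot arr svc pol z) (fun w => (((1 + w.load) ^ k : ℕ) : ℝ≥0∞)) ≤
      ENNReal.ofReal C := by
  set C : ℝ≥0∞ := (((M + N + 1) ^ k : ℕ) : ℝ≥0∞) *
    (1 + (∑ m, mean arr (fun a => ((a m ^ k : ℕ) : ℝ≥0∞)) +
      ∑ n, mean (svc n) (fun s => ((s ^ k : ℕ) : ℝ≥0∞))))
  have hC : C ≠ ∞ := by
    refine ENNReal.mul_ne_top (ENNReal.natCast_ne_top _) (ENNReal.add_ne_top.2 ⟨by simp, ?_⟩)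
    exact ENNReal.add_ne_top.2 ⟨ENNReal.sum_ne_top.2 fun m _ => (harr.mean_pow_lt_top m k).ne,
      ENNReal.sum_ne_top.2 fun n _ => (hsvc.mean_pow_lt_top n k).ne⟩
  refine ⟨C.toReal, ENNReal.toReal_nonneg, fun z => ?_⟩
  rw [ENNReal.ofReal_toReal hC]
  have hpt : ∀ w : Slot M N, (((1 + w.load) ^ k : ℕ) : ℝ≥0∞) ≤ (((M + N + 1) ^ k : ℕ) : ℝ≥0∞) *
      (1 + (∑ m, ((w.arrivals m ^ k : ℕ) : ℝ≥0∞) + ∑ n, ((w.service n ^ k : ℕ) : ℝ≥0∞))) := by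
    intro w
    have h := one_add_sum_pow_le Finset.univ (Sum.elim w.arrivals w.service) k
    rw [Fintype.sum_sum_type, Fintype.sum_sum_type, Finset.card_univ, Fintype.card_sum,
      Fintype.card_fin, Fintype.card_fin] at h
    simp only [Sum.elim_inl, Sum.elim_inr] at h
    exact_mod_cast h
  refine (mean_mono hpt).trans_eq ?_
  rw [mean_const_mul, mean_add, mean_add, mean_const, mean_sum, mean_sum]
  simp only [mean_slot_service arr svc pol z _ fun s => ((s ^ k : ℕ) : ℝ≥0∞)]
  simp only [fun m => mean_slot_arrivals arr svc pol z fun a => ((a m ^ k : ℕ) : ℝ≥0∞)]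
  rfl

theorem ServiceAssumptions.mean_ne_top {svc : Fin N → PMF ℕ} (h : ServiceAssumptions svc)
    (n : Fin N) : mean (svc n) (fun s => (s : ℝ≥0∞)) ≠ ∞ := by
  simpa using (h.mean_pow_lt_top n 1).ne

theorem ArrivalAssumptions.mean_ne_top {arr : PMF (Fin M → ℕ)} (h : ArrivalAssumptions arr)
    (m : Fin M) : mean arr (fun a => (a m : ℝ≥0∞)) ≠ ∞ := by
  simpa using (h.mean_pow_lt_top m 1).ne

theorem serviceRate_eq_toReal (svc : Fin N → PMF ℕ) (n : Fin N) :
    serviceRate svc n = (mean (svc n) (fun s => (s : ℝ≥0∞))).toReal := by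
  rw [mean, ENNReal.tsum_toReal_eq fun s =>
    ENNReal.mul_ne_top (PMF.apply_ne_top _ _) (ENNReal.natCast_ne_top s)]
  simp [serviceRate, ENNReal.toReal_mul]

theorem arrivalRate_eq_sum {arr : PMF (Fin M → ℕ)} (h : ArrivalAssumptions arr) :
    arrivalRate arr = ∑ m, (mean arr (fun a => (a m : ℝ≥0∞))).toReal := by
  rw [← ENNReal.toReal_sum fun m _ => h.mean_ne_top m, ← mean_sum, mean,
    ENNReal.tsum_toReal_eq fun a => ENNReal.mul_ne_top (PMF.apply_ne_top _ _)
      (ENNReal.sum_ne_top.2 fun m _ => ENNReal.natCast_ne_top _)]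
  refine tsum_congr fun a => ?_
  rw [ENNReal.toReal_mul, ENNReal.toReal_sum fun m _ => ENNReal.natCast_ne_top _]
  simp

/-! ### Drift of the queues and of the estimation errors -/

section Drift

variable {arr : PMF (Fin M → ℕ)} {svc : Fin N → PMF ℕ} {pol : Policy M N}

/-- The error of the estimate of dispatcher `m` for server `n`. -/
def gap (z : State M N) (m : Fin M) (n : Fin N) : ℕ := Nat.dist (z.1 n) (z.2 m n)

/-- The expectation of `queue_pow_le`. The service term stays on the left until finiteness allows
passing from `ℝ≥0∞` to `ℝ`. -/
theorem mean_nextQueue_pow_le (harr : ArrivalAssumptions arr) (hsvc : ServiceAssumptions svc)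
    (pol : Policy M N) (k : ℕ) :
    ∃ C : ℝ, 0 ≤ C ∧ ∀ z n,
      mean (slot arr svc pol z) (fun w => ((w.nextQueue z.1 n ^ (k + 2) : ℕ) : ℝ≥0∞)) ≠ ∞ ∧
      (mean (slot arr svc pol z) (fun w => ((w.nextQueue z.1 n ^ (k + 2) : ℕ) : ℝ≥0∞))).toReal ≤
        (z.1 n : ℝ) ^ (k + 2) + (k + 2) * (z.1 n : ℝ) ^ (k + 1) *
          (∑ m, (mean arr fun a => (a m : ℝ≥0∞)).toReal * (pol.dispatch m (z.2 m) n).toReal -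
            serviceRate svc n) + C * (1 + (z.1 n : ℝ)) ^ k := by
  obtain ⟨C, hC, hload⟩ := exists_mean_load_pow_le harr hsvc pol (k + 2)
  refine ⟨(k + 2) * (k + 1) * C, by positivity, fun z n => ?_⟩
  set E := mean (slot arr svc pol z) (fun w => ((w.nextQueue z.1 n ^ (k + 2) : ℕ) : ℝ≥0∞))
  set x := z.1 n
  have hpt : ∀ w : Slot M N, ((w.nextQueue z.1 n ^ (k + 2) : ℕ) : ℝ≥0∞) +
      (((k + 2) * x ^ (k + 1) : ℕ) : ℝ≥0∞) * (w.service n : ℝ≥0∞) ≤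
      (((x ^ (k + 2) : ℕ) : ℝ≥0∞) +
        (((k + 2) * x ^ (k + 1) : ℕ) : ℝ≥0∞) * ∑ m, (w.routed m n : ℝ≥0∞)) +
        (((k + 2) * (k + 1) * (1 + x) ^ k : ℕ) : ℝ≥0∞) * (((1 + w.load) ^ (k + 2) : ℕ) : ℝ≥0∞) := by
    intro w
    have h := queue_pow_le (x := x) (w.sum_routed_add_service_le_load n) k
    rw [← mul_assoc _ ((1 + x) ^ k)] at h
    exact_mod_cast h
  have hmean := mean_mono (p := slot arr svc pol z) hpt
  rw [mean_add, mean_add, mean_add, mean_const, mean_const_mul, mean_const_mul, mean_const_mul,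
    mean_sum, mean_slot_service arr svc pol z n fun s => (s : ℝ≥0∞)] at hmean
  simp only [mean_slot_routed] at hmean
  replace hmean := hmean.trans (add_le_add_right (mul_le_mul_right (hload z) _) _)
  have hsum : ∀ m ∈ Finset.univ, (mean arr fun a => (a m : ℝ≥0∞)) * pol.dispatch m (z.2 m) n ≠ ∞ :=
    fun m _ => ENNReal.mul_ne_top (harr.mean_ne_top m) (PMF.apply_ne_top _ _)
  have hA := ENNReal.mul_ne_top (ENNReal.natCast_ne_top ((k + 2) * x ^ (k + 1)))
    (ENNReal.sum_ne_top.2 hsum)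
  have hS := ENNReal.mul_ne_top (ENNReal.natCast_ne_top ((k + 2) * x ^ (k + 1)))
    (hsvc.mean_ne_top n)
  have hL := ENNReal.mul_ne_top (ENNReal.natCast_ne_top ((k + 2) * (k + 1) * (1 + x) ^ k))
    (ENNReal.ofReal_ne_top (r := C))
  have hx := ENNReal.natCast_ne_top (x ^ (k + 2))
  have hE : E ≠ ∞ := ne_top_of_le_ne_top
    (ENNReal.add_ne_top.2 ⟨ENNReal.add_ne_top.2 ⟨hx, hA⟩, hL⟩) (le_self_add.trans hmean)
  refine ⟨hE, ?_⟩
  have hreal := ENNReal.toReal_mono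
    (ENNReal.add_ne_top.2 ⟨ENNReal.add_ne_top.2 ⟨hx, hA⟩, hL⟩) hmean
  rw [ENNReal.toReal_add hE hS, ENNReal.toReal_add (ENNReal.add_ne_top.2 ⟨hx, hA⟩) hL,
    ENNReal.toReal_add hx hA, ENNReal.toReal_mul, ENNReal.toReal_mul, ENNReal.toReal_mul,
    ENNReal.toReal_sum hsum, ENNReal.toReal_ofReal hC, ← serviceRate_eq_toReal] at hreal
  simp only [ENNReal.toReal_mul, ENNReal.toReal_natCast] at hreal
  push_cast at hreal
  linarith

/-- The drift of the queue lengths. -/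
theorem exists_queue_drift (harr : ArrivalAssumptions arr) (hsvc : ServiceAssumptions svc)
    (htilt : ∀ m, IsTilted (serviceRate svc) (pol.dispatch m)) {ε : ℝ} (hε : 0 < ε)
    (hrate : arrivalRate arr = ∑ n, serviceRate svc n - ε) (k : ℕ) :
    ∃ c K : ℝ, 0 < c ∧ 0 ≤ K ∧ ∀ z,
      ∑ n, (mean (slot arr svc pol z)
        (fun w => ((w.nextQueue z.1 n ^ (k + 2) : ℕ) : ℝ≥0∞))).toReal ≤
      ∑ n, (z.1 n : ℝ) ^ (k + 2) - c * ∑ n, (z.1 n : ℝ) ^ (k + 1) +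
        K * (1 + ∑ m, ∑ n, (gap z m n : ℝ) ^ (k + 1)) := by
  set μ := serviceRate svc
  set L : Fin M → ℝ := fun m => (mean arr fun a => (a m : ℝ≥0∞)).toReal
  have hμ : ∀ n, 0 < μ n := hsvc.rate_pos
  have hL : ∀ m, 0 ≤ L m := fun m => ENNReal.toReal_nonneg
  have hLsum : ∑ m, L m = ∑ n, μ n - ε := (arrivalRate_eq_sum harr).symm.trans hrate
  have hΛ : 0 ≤ ∑ m, L m := Finset.sum_nonneg fun m _ => hL m
  have hμsum : 0 < ∑ n, μ n := by linarith
  obtain ⟨C, hC, hstep⟩ := mean_nextQueue_pow_le harr hsvc pol k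
  -- `ε * μ n / ∑ j, μ j` is the excess of service over arrivals at server `n` under random routing
  -- proportional to the service rates.
  obtain ⟨c₀, hc₀, hc₀le⟩ : ∃ c₀ : ℝ, 0 < c₀ ∧ ∀ n, c₀ ≤ ε * μ n / ∑ j, μ j := by
    have hpos : ∀ n, 0 < ε * μ n / ∑ j, μ j := fun n => by have := hμ n; positivity
    rcases isEmpty_or_nonempty (Fin N) with hN | hN
    · exact ⟨1, one_pos, fun n => hN.elim n⟩
    · obtain ⟨n₀, -, hn₀⟩ := Finset.exists_min_image Finset.univ (fun n => ε * μ n / ∑ j, μ j)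
        Finset.univ_nonempty
      exact ⟨_, hpos n₀, fun n => hn₀ n (Finset.mem_univ n)⟩
  -- The two values of `η` let the estimation cost and the second-order term each consume at most
  -- `c₀ / 4 * S`; the `+ 1` keeps the denominators positive.
  obtain ⟨K₁, hK₁, hY₁⟩ := exists_mul_add_pow_le k
    (η := c₀ / (4 * ((k + 1) * (∑ m, L m + 1)))) (by positivity)
  obtain ⟨K₂, hK₂, hY₂⟩ := exists_mul_add_pow_le k (η := c₀ / (4 * (C + 1))) (by positivity)
  set Λ := ∑ m, L m
  refine ⟨c₀, (k + 2) * ((k + 1) * (Λ * K₁)) + C * K₂ * N, hc₀, by positivity, fun z => ?_⟩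
  set S := ∑ n, (z.1 n : ℝ) ^ (k + 1)
  set T := ∑ m, ∑ n, (gap z m n : ℝ) ^ (k + 1)
  have hS : 0 ≤ S := Finset.sum_nonneg fun n _ => by positivity
  have hT : 0 ≤ T := Finset.sum_nonneg fun m _ => Finset.sum_nonneg fun n _ => by positivity
  have hlow : C * ∑ n, (1 + (z.1 n : ℝ)) ^ k ≤ c₀ / 4 * S + C * K₂ * N := by
    have h₁ : ∑ n, (1 + (z.1 n : ℝ)) ^ k ≤ c₀ / (4 * (C + 1)) * S + K₂ * N := by
      calc _ ≤ ∑ n, (c₀ / (4 * (C + 1)) * (z.1 n : ℝ) ^ (k + 1) + K₂) :=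
            Finset.sum_le_sum fun n _ => by
              simpa [add_comm] using hY₂ (z.1 n) 1 (z.1 n).cast_nonneg zero_le_one
        _ = _ := by
            rw [Finset.sum_add_distrib, ← Finset.mul_sum]
            simp [mul_comm, S]
    have h₂ : C * (c₀ / (4 * (C + 1))) ≤ c₀ / 4 := by
      rw [mul_div_assoc', div_le_div_iff₀ (by positivity) (by positivity)]
      nlinarith
    calc _ ≤ C * (c₀ / (4 * (C + 1)) * S + K₂ * N) := by gcongr
      _ = C * (c₀ / (4 * (C + 1))) * S + C * K₂ * N := by ring
      _ ≤ _ := by gcongr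
  have hdisp : ∀ m, ∑ n, (z.1 n : ℝ) ^ (k + 1) * ((pol.dispatch m (z.2 m) n).toReal -
      μ n / ∑ j, μ j) ≤ c₀ / (4 * (Λ + 1)) * S + (k + 1) * (K₁ * T) := by
    intro m
    refine ((htilt m).sum_pow_le hμ z.1 (z.2 m) k).trans ?_
    calc _ ≤ ∑ n, (k + 1) * (c₀ / (4 * ((k + 1) * (Λ + 1))) * (z.1 n : ℝ) ^ (k + 1) +
          K₁ * (gap z m n : ℝ) ^ (k + 1)) := by
          refine Finset.sum_le_sum fun n _ => ?_
          gcongr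
          exact hY₁ _ _ (Nat.cast_nonneg _) (Nat.cast_nonneg _)
      _ = c₀ / (4 * (Λ + 1)) * S + (k + 1) * (K₁ * ∑ n, (gap z m n : ℝ) ^ (k + 1)) := by
          rw [← Finset.mul_sum, Finset.sum_add_distrib, ← Finset.mul_sum, ← Finset.mul_sum, mul_add]
          congr 1
          field_simp
          rfl
      _ ≤ _ := by
          gcongr
          exact Finset.single_le_sum (f := fun m => ∑ n, (gap z m n : ℝ) ^ (k + 1))
            (fun m _ => Finset.sum_nonneg fun n _ => by positivity) (Finset.mem_univ m)
  have hmain : ∑ n, (z.1 n : ℝ) ^ (k + 1) *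
      (∑ m, L m * (pol.dispatch m (z.2 m) n).toReal - μ n) ≤
        c₀ / 4 * S + (k + 1) * (Λ * K₁) * T - c₀ * S := by
    -- Comparison with proportional routing, for which `Λ * (μ n / ∑ j, μ j) - μ n = -(ε * μ n / ∑
    -- j, μ j)`.
    have hsplit : ∑ n, (z.1 n : ℝ) ^ (k + 1) *
        (∑ m, L m * (pol.dispatch m (z.2 m) n).toReal - μ n) =
        ∑ m, L m * ∑ n, (z.1 n : ℝ) ^ (k + 1) * ((pol.dispatch m (z.2 m) n).toReal -
          μ n / ∑ j, μ j) - ∑ n, (ε * μ n / ∑ j, μ j) * (z.1 n : ℝ) ^ (k + 1) := by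
      have h : ∑ m, L m * ∑ n, (z.1 n : ℝ) ^ (k + 1) * ((pol.dispatch m (z.2 m) n).toReal -
          μ n / ∑ j, μ j) = ∑ n, (z.1 n : ℝ) ^ (k + 1) *
            (∑ m, L m * (pol.dispatch m (z.2 m) n).toReal - Λ * (μ n / ∑ j, μ j)) := by
        simp only [Finset.mul_sum]
        rw [Finset.sum_comm]
        refine Finset.sum_congr rfl fun n _ => ?_
        rw [Finset.sum_mul, ← Finset.sum_sub_distrib, Finset.mul_sum]
        exact Finset.sum_congr rfl fun m _ => by ring
      rw [h, ← Finset.sum_sub_distrib]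
      refine Finset.sum_congr rfl fun n _ => ?_
      rw [hLsum]
      field_simp
      ring
    have h₁ : ∑ m, L m * ∑ n, (z.1 n : ℝ) ^ (k + 1) * ((pol.dispatch m (z.2 m) n).toReal -
        μ n / ∑ j, μ j) ≤ Λ * (c₀ / (4 * (Λ + 1)) * S + (k + 1) * (K₁ * T)) := by
      rw [Finset.sum_mul]
      exact Finset.sum_le_sum fun m _ => mul_le_mul_of_nonneg_left (hdisp m) (hL m)
    have h₂ : c₀ * S ≤ ∑ n, (ε * μ n / ∑ j, μ j) * (z.1 n : ℝ) ^ (k + 1) := by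
      rw [Finset.mul_sum]
      exact Finset.sum_le_sum fun n _ => mul_le_mul_of_nonneg_right (hc₀le n) (by positivity)
    have h₃ : Λ * (c₀ / (4 * (Λ + 1))) ≤ c₀ / 4 := by
      rw [mul_div_assoc', div_le_div_iff₀ (by positivity) (by positivity)]
      nlinarith
    have h₄ := mul_le_mul_of_nonneg_right h₃ hS
    rw [hsplit]
    linarith
  calc _ ≤ ∑ n, ((z.1 n : ℝ) ^ (k + 2) + (k + 2) * (z.1 n : ℝ) ^ (k + 1) *
          (∑ m, L m * (pol.dispatch m (z.2 m) n).toReal - μ n) + C * (1 + (z.1 n : ℝ)) ^ k) :=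
        Finset.sum_le_sum fun n _ => (hstep z n).2
    _ = ∑ n, (z.1 n : ℝ) ^ (k + 2) + (k + 2) * ∑ n, (z.1 n : ℝ) ^ (k + 1) *
          (∑ m, L m * (pol.dispatch m (z.2 m) n).toReal - μ n) +
            C * ∑ n, (1 + (z.1 n : ℝ)) ^ k := by
        rw [Finset.sum_add_distrib, Finset.sum_add_distrib, Finset.mul_sum, Finset.mul_sum]
        simp only [mul_assoc]
    _ ≤ _ := by
        -- The coefficient of `c₀ * S` is `1/4 - (k + 2) * 3/4`, which is at most `-1`.
        have h₁ := mul_le_mul_of_nonneg_left hmain (by positivity : (0 : ℝ) ≤ k + 2)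
        have h₂ : 0 ≤ (k : ℝ) * (c₀ * S) := by positivity
        have h₃ : 0 ≤ C * K₂ * N * T := by positivity
        have h₄ : 0 ≤ ((k : ℝ) + 2) * ((k + 1) * (Λ * K₁)) := by positivity
        have h₅ : 0 ≤ c₀ * S := by positivity
        linarith

/-- The drift of the estimation errors. -/
theorem exists_gap_drift (harr : ArrivalAssumptions arr) (hsvc : ServiceAssumptions svc)
    {p : ℝ} (hp : 0 < p) (k : ℕ) :
    ∃ K : ℝ, 0 ≤ K ∧ ∀ z m n, ENNReal.ofReal p ≤ refreshProb arr svc pol z m n →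
      mean (slot arr svc pol z) (fun w =>
        ((gap (w.nextQueue z.1, w.nextEstimate z) m n ^ (k + 1) : ℕ) : ℝ≥0∞)) ≠ ∞ ∧
      (mean (slot arr svc pol z) (fun w =>
        ((gap (w.nextQueue z.1, w.nextEstimate z) m n ^ (k + 1) : ℕ) : ℝ≥0∞))).toReal ≤
        (gap z m n : ℝ) ^ (k + 1) - p / 2 * (gap z m n : ℝ) ^ (k + 1) + K := by
  obtain ⟨C, hC, hload⟩ := exists_mean_load_pow_le harr hsvc pol (k + 1)
  -- With this `η` the growth of the error consumes at most half of the gain `p * d ^ (k + 1)` from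
  -- refreshing.
  obtain ⟨K, hK, hY⟩ := exists_mul_add_pow_le k (η := p / (2 * ((k + 1) * (C + 1))))
    (by positivity)
  refine ⟨(k + 1) * C * K, by positivity, fun z m n hz => ?_⟩
  set E := mean (slot arr svc pol z) (fun w =>
    ((gap (w.nextQueue z.1, w.nextEstimate z) m n ^ (k + 1) : ℕ) : ℝ≥0∞))
  set d := gap z m n
  -- The inequality holds slot by slot: a refresh makes the new error `0` and frees `d ^ (k + 1)`.
  -- Hence the refresh rule may depend on the load in any way; only its probability enters.
  have hpt : ∀ w : Slot M N,
      ((gap (w.nextQueue z.1, w.nextEstimate z) m n ^ (k + 1) : ℕ) : ℝ≥0∞) +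
        ((d ^ (k + 1) : ℕ) : ℝ≥0∞) *
          {w : Slot M N | w.action m n = Action.refresh}.indicator (fun _ => 1) w ≤
      ((d ^ (k + 1) : ℕ) : ℝ≥0∞) +
        (((k + 1) * (1 + d) ^ k : ℕ) : ℝ≥0∞) * (((1 + w.load) ^ (k + 1) : ℕ) : ℝ≥0∞) := by
    intro w
    by_cases hw : w.action m n = Action.refresh
    · have h0 : gap (w.nextQueue z.1, w.nextEstimate z) m n = 0 :=
        w.dist_nextEstimate_of_refresh z hw
      simp [hw, h0]
    · have h := gap_pow_le (w.dist_nextEstimate_le z m n) k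
      rw [← mul_assoc] at h
      simp only [Set.mem_ofPred_eq, hw, not_false_eq_true, Set.indicator_of_notMem, mul_zero,
        add_zero]
      exact_mod_cast h
  have hmean := mean_mono (p := slot arr svc pol z) hpt
  rw [mean_add, mean_add, mean_const, mean_const_mul, mean_const_mul, mean_indicator_one] at hmean
  replace hmean := (add_le_add_right (mul_le_mul_right hz _) _).trans
    (hmean.trans (add_le_add_right (mul_le_mul_right (hload z) _) _))
  have hd := ENNReal.natCast_ne_top (d ^ (k + 1))
  have hL := ENNReal.mul_ne_top (ENNReal.natCast_ne_top ((k + 1) * (1 + d) ^ k))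
    (ENNReal.ofReal_ne_top (r := C))
  have hP := ENNReal.mul_ne_top hd (ENNReal.ofReal_ne_top (r := p))
  have hE : E ≠ ∞ := ne_top_of_le_ne_top (ENNReal.add_ne_top.2 ⟨hd, hL⟩)
    (le_self_add.trans hmean)
  refine ⟨hE, ?_⟩
  have hreal := ENNReal.toReal_mono (ENNReal.add_ne_top.2 ⟨hd, hL⟩) hmean
  rw [ENNReal.toReal_add hE hP, ENNReal.toReal_add hd hL, ENNReal.toReal_mul, ENNReal.toReal_mul,
    ENNReal.toReal_ofReal hp.le, ENNReal.toReal_ofReal hC] at hreal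
  simp only [ENNReal.toReal_natCast] at hreal
  push_cast at hreal
  have h₁ : (1 + (d : ℝ)) ^ k ≤ p / (2 * ((k + 1) * (C + 1))) * (d : ℝ) ^ (k + 1) + K := by
    simpa [add_comm] using hY d 1 d.cast_nonneg zero_le_one
  have h₂ : (k + 1) * C * (p / (2 * ((k + 1) * (C + 1)))) ≤ p / 2 := by
    rw [mul_div_assoc', div_le_div_iff₀ (by positivity) (by positivity)]
    have : 0 ≤ ((k : ℝ) + 1) * p := by positivity
    nlinarith
  have h₃ := mul_le_mul_of_nonneg_left h₁ (by positivity : 0 ≤ (k + 1) * C)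
  have h₄ := mul_le_mul_of_nonneg_right h₂ (by positivity : 0 ≤ (d : ℝ) ^ (k + 1))
  linarith

end Drift

end LED


/-! ### The Lyapunov function and its drift -/

namespace LED

open MarkovChain

variable {M N : ℕ} {arr : PMF (Fin M → ℕ)} {svc : Fin N → PMF ℕ} {pol : Policy M N}

/-- The Lyapunov function: powers of the queue lengths, and one degree lower powers of the
estimation errors. -/
def lyapunov (c : ℝ) (k : ℕ) (z : State M N) : ℝ≥0∞ :=
  ∑ n, ((z.1 n ^ (k + 2) : ℕ) : ℝ≥0∞) +
    ENNReal.ofReal c * ∑ m, ∑ n, ((gap z m n ^ (k + 1) : ℕ) : ℝ≥0∞)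

/-- The size of a state, measured by powers of the queue lengths and of the estimation errors. -/
def powSize (k : ℕ) (z : State M N) : ℕ :=
  ∑ n, z.1 n ^ (k + 1) + ∑ m, ∑ n, gap z m n ^ (k + 1)

theorem lyapunov_ne_top (c : ℝ) (k : ℕ) (z : State M N) : lyapunov c k z ≠ ∞ := by
  refine ENNReal.add_ne_top.2 ⟨ENNReal.sum_ne_top.2 fun n _ => ENNReal.natCast_ne_top _,
    ENNReal.mul_ne_top ENNReal.ofReal_ne_top ?_⟩
  exact ENNReal.sum_ne_top.2 fun m _ => ENNReal.sum_ne_top.2 fun n _ => ENNReal.natCast_ne_top _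

/-- The queue drift tolerates errors of power `k + 1`, precisely the power that refreshing
contracts; hence the two different degrees in `lyapunov`. -/
theorem exists_lyapunov_drift (harr : ArrivalAssumptions arr) (hsvc : ServiceAssumptions svc)
    (htilt : ∀ m, IsTilted (serviceRate svc) (pol.dispatch m)) {ε : ℝ} (hε : 0 < ε)
    (hrate : arrivalRate arr = ∑ n, serviceRate svc n - ε) {p : ℝ} (hp : 0 < p) (k : ℕ) :
    ∃ c δ K : ℝ, 0 < δ ∧ 0 ≤ K ∧ ∀ z,
      (∀ m n, ENNReal.ofReal p ≤ refreshProb arr svc pol z m n) →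
        mean (step arr svc pol z) (lyapunov c k) + ENNReal.ofReal δ * powSize k z ≤
          lyapunov c k z + ENNReal.ofReal K := by
  obtain ⟨c₁, K₁, hc₁, hK₁, hqueue⟩ := exists_queue_drift (pol := pol) harr hsvc htilt hε hrate k
  obtain ⟨_, -, hqfin⟩ := mean_nextQueue_pow_le harr hsvc pol k
  obtain ⟨K₂, hK₂, hgap⟩ := exists_gap_drift (pol := pol) harr hsvc hp k
  -- Then `c * (p / 2) = K₁ + 1`: this covers the cost `K₁` in the queue drift and leaves one unit
  -- of decrease in the errors.
  obtain ⟨c, hc⟩ : ∃ c, c = 2 * (K₁ + 1) / p := ⟨_, rfl⟩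
  have hc0 : 0 ≤ c := by rw [hc]; positivity
  refine ⟨c, min c₁ 1, K₁ + c * (M * (N * K₂)), by positivity, by positivity, fun z hz => ?_⟩
  set EQ : Fin N → ℝ≥0∞ := fun n =>
    mean (slot arr svc pol z) (fun w => ((w.nextQueue z.1 n ^ (k + 2) : ℕ) : ℝ≥0∞))
  set EG : Fin M → Fin N → ℝ≥0∞ := fun m n => mean (slot arr svc pol z) (fun w =>
    ((gap (w.nextQueue z.1, w.nextEstimate z) m n ^ (k + 1) : ℕ) : ℝ≥0∞))
  have hEQ : ∀ n ∈ Finset.univ, EQ n ≠ ∞ := fun n _ => (hqfin z n).1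
  have hEG : ∀ m, ∀ n ∈ Finset.univ, EG m n ≠ ∞ := fun m n _ => (hgap z m n (hz m n)).1
  have hEGs : ∀ m ∈ Finset.univ, ∑ n, EG m n ≠ ∞ := fun m _ => ENNReal.sum_ne_top.2 (hEG m)
  have hmean : mean (step arr svc pol z) (lyapunov c k) =
      ∑ n, EQ n + ENNReal.ofReal c * ∑ m, ∑ n, EG m n := by
    unfold step lyapunov
    rw [mean_map, mean_add, mean_const_mul, mean_sum, mean_sum]
    simp only [mean_sum]
    rfl
  have hmean_top := ENNReal.add_ne_top.2 ⟨ENNReal.sum_ne_top.2 hEQ,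
    ENNReal.mul_ne_top (ENNReal.ofReal_ne_top (r := c)) (ENNReal.sum_ne_top.2 hEGs)⟩
  have hsize_top := ENNReal.mul_ne_top (ENNReal.ofReal_ne_top (r := min c₁ 1))
    (ENNReal.natCast_ne_top (powSize k z))
  have hV : (lyapunov c k z).toReal = ∑ n, (z.1 n : ℝ) ^ (k + 2) +
      c * ∑ m, ∑ n, (gap z m n : ℝ) ^ (k + 1) := by
    have hG : ∀ m ∈ Finset.univ, ∑ n, ((gap z m n ^ (k + 1) : ℕ) : ℝ≥0∞) ≠ ∞ := fun m _ =>
      ENNReal.sum_ne_top.2 fun n _ => ENNReal.natCast_ne_top _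
    rw [lyapunov, ENNReal.toReal_add (ENNReal.sum_ne_top.2 fun n _ => ENNReal.natCast_ne_top _)
        (ENNReal.mul_ne_top ENNReal.ofReal_ne_top (ENNReal.sum_ne_top.2 hG)), ENNReal.toReal_mul,
      ENNReal.toReal_ofReal hc0, ENNReal.toReal_sum hG,
      ENNReal.toReal_sum fun n _ => ENNReal.natCast_ne_top _]
    simp only [fun m => ENNReal.toReal_sum (s := Finset.univ)
      (f := fun n => ((gap z m n ^ (k + 1) : ℕ) : ℝ≥0∞)) fun n _ => ENNReal.natCast_ne_top _,
      ENNReal.toReal_natCast]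
    simp only [Nat.cast_pow]
  rw [hmean, ← ENNReal.toReal_le_toReal (ENNReal.add_ne_top.2 ⟨hmean_top, hsize_top⟩)
      (ENNReal.add_ne_top.2 ⟨lyapunov_ne_top c k z, ENNReal.ofReal_ne_top⟩),
    ENNReal.toReal_add hmean_top hsize_top,
    ENNReal.toReal_add (ENNReal.sum_ne_top.2 hEQ)
      (ENNReal.mul_ne_top ENNReal.ofReal_ne_top (ENNReal.sum_ne_top.2 hEGs)),
    ENNReal.toReal_add (lyapunov_ne_top c k z) ENNReal.ofReal_ne_top, ENNReal.toReal_mul,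
    ENNReal.toReal_mul, ENNReal.toReal_ofReal hc0, ENNReal.toReal_ofReal (by positivity),
    ENNReal.toReal_ofReal (by positivity), ENNReal.toReal_sum hEQ, ENNReal.toReal_sum hEGs, hV,
    ENNReal.toReal_natCast, powSize]
  simp only [fun m => ENNReal.toReal_sum (hEG m)]
  push_cast
  set S := ∑ n, (z.1 n : ℝ) ^ (k + 1)
  set T := ∑ m, ∑ n, (gap z m n : ℝ) ^ (k + 1)
  have hS : 0 ≤ S := Finset.sum_nonneg fun n _ => by positivity
  have hT : 0 ≤ T := Finset.sum_nonneg fun m _ => Finset.sum_nonneg fun n _ => by positivity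
  have h₁ : ∑ m, ∑ n, (EG m n).toReal ≤ T - p / 2 * T + M * (N * K₂) := by
    calc _ ≤ ∑ m, ∑ n, ((gap z m n : ℝ) ^ (k + 1) - p / 2 * (gap z m n : ℝ) ^ (k + 1) + K₂) :=
          Finset.sum_le_sum fun m _ => Finset.sum_le_sum fun n _ => (hgap z m n (hz m n)).2
      _ = _ := by
          simp only [Finset.sum_add_distrib, Finset.sum_sub_distrib, ← Finset.mul_sum]
          simp [T]
  have h₂ := mul_le_mul_of_nonneg_left h₁ hc0
  have h₃ : c * (p / 2 * T) = (K₁ + 1) * T := by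
    rw [hc]
    field_simp
  have h₄ := hqueue z
  have h₅ : min c₁ 1 * S ≤ c₁ * S := mul_le_mul_of_nonneg_right (min_le_left _ _) hS
  have h₆ : min c₁ 1 * T ≤ 1 * T := mul_le_mul_of_nonneg_right (min_le_right _ _) hT
  linarith

/-- An estimate is at most the queue length plus its error, hence at most `2 * B`. -/
theorem finite_powSize_le (B : ℕ) : {z : State M N | powSize 0 z ≤ B}.Finite := by
  refine ((Set.finite_Icc (0 : Fin N → ℕ) fun _ => B).prod
    (Set.finite_Icc (0 : Fin M → Fin N → ℕ) fun _ _ => 2 * B)).subset fun z hz => ?_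
  have hz' : ∑ n, z.1 n + ∑ m, ∑ n, gap z m n ≤ B := by simpa [powSize] using hz
  have hq : ∀ n, z.1 n ≤ B := fun n =>
    ((Finset.single_le_sum (f := z.1) (fun _ _ => Nat.zero_le _) (Finset.mem_univ n)).trans
      (Nat.le_add_right _ _)).trans hz'
  have hg : ∀ m n, gap z m n ≤ B := fun m n =>
    (((Finset.single_le_sum (f := gap z m) (fun _ _ => Nat.zero_le _) (Finset.mem_univ n)).trans
      (Finset.single_le_sum (f := fun m => ∑ n, gap z m n) (fun _ _ => Nat.zero_le _)
        (Finset.mem_univ m))).trans (Nat.le_add_left _ _)).trans hz'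
  refine ⟨⟨fun n => Nat.zero_le _, hq⟩, fun m n => Nat.zero_le _, fun m n => ?_⟩
  have h₁ := hq n
  have h₂ := hg m n
  unfold gap Nat.dist at h₂
  show z.2 m n ≤ 2 * B
  omega

/-- A Foster–Lyapunov drift of the load balancing chain towards a finite set of states. -/
theorem exists_foster (harr : ArrivalAssumptions arr) (hsvc : ServiceAssumptions svc)
    (htilt : ∀ m, IsTilted (serviceRate svc) (pol.dispatch m)) {ε : ℝ} (hε : 0 < ε)
    (hrate : arrivalRate arr = ∑ n, serviceRate svc n - ε) {p : ℝ} (hp : 0 < p) :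
    ∃ (V : State M N → ℝ≥0∞) (F : Set (State M N)), F.Finite ∧ ∀ z,
      (∀ m n, ENNReal.ofReal p ≤ refreshProb arr svc pol z m n) →
        mean (step arr svc pol z) V < ∞ ∧ (z ∉ F → mean (step arr svc pol z) V + 1 ≤ V z) := by
  obtain ⟨c, δ, K, hδ, hK, hdrift⟩ :=
    exists_lyapunov_drift (pol := pol) harr hsvc htilt hε hrate hp 0
  obtain ⟨B, hB⟩ := exists_nat_ge ((K + 1) / δ)
  refine ⟨lyapunov c 0, {z | powSize 0 z ≤ B}, finite_powSize_le B, fun z hz => ⟨?_, fun hzF => ?_⟩⟩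
  · exact (le_self_add.trans (hdrift z hz)).trans_lt
      (ENNReal.add_lt_top.2 ⟨(lyapunov_ne_top c 0 z).lt_top, ENNReal.ofReal_lt_top⟩)
  · have hlt : (B : ℝ) ≤ powSize 0 z := by
      have : B < powSize 0 z := not_le.1 hzF
      exact_mod_cast this.le
    have hsize : 1 + ENNReal.ofReal K ≤ ENNReal.ofReal δ * powSize 0 z := by
      rw [← ENNReal.ofReal_one, ← ENNReal.ofReal_add zero_le_one hK, ← ENNReal.ofReal_natCast,
        ← ENNReal.ofReal_mul hδ.le]
      refine ENNReal.ofReal_le_ofReal ?_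
      have := (div_le_iff₀ hδ).1 (hB.trans hlt)
      linarith
    refine (ENNReal.add_le_add_iff_right (ENNReal.ofReal_ne_top (r := K))).1 ?_
    rw [add_assoc]
    exact (add_le_add_right hsize _).trans (hdrift z hz)

/-! ### Moments of the queue lengths -/

theorem queueNorm_le_sum (q : Fin N → ℕ) : queueNorm q ≤ ∑ n, (q n : ℝ) := by
  rw [queueNorm, EuclideanSpace.norm_eq]
  refine Real.sqrt_le_iff.2 ⟨by positivity, ?_⟩
  simpa using Finset.sum_sq_le_sq_sum_of_nonneg (s := Finset.univ) (f := fun n => (q n : ℝ))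
    fun n _ => (q n).cast_nonneg

/-- `powSize r` holds powers `r + 1`; the base `1 + ∑ n, z.1 n` is at least one, so the exponent `r`
may be raised. -/
theorem ofReal_queueNorm_pow_le (z : State M N) (r : ℕ) :
    ENNReal.ofReal (queueNorm z.1 ^ r) ≤
      (((N + 1) ^ (r + 1) : ℕ) : ℝ≥0∞) * (1 + powSize r z) := by
  have h₁ : queueNorm z.1 ^ r ≤ (((1 + ∑ n, z.1 n) ^ (r + 1) : ℕ) : ℝ) := by
    have h0 : 0 ≤ queueNorm z.1 := norm_nonneg _
    have hs := queueNorm_le_sum z.1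
    push_cast
    calc queueNorm z.1 ^ r ≤ (1 + ∑ n, (z.1 n : ℝ)) ^ r := by
          gcongr
          linarith
      _ ≤ _ := pow_le_pow_right₀ (by linarith) r.le_succ
  have h₂ := one_add_sum_pow_le Finset.univ z.1 (r + 1)
  rw [Finset.card_univ, Fintype.card_fin] at h₂
  have h₃ : (1 + ∑ n, z.1 n) ^ (r + 1) ≤ (N + 1) ^ (r + 1) * (1 + powSize r z) :=
    h₂.trans (Nat.mul_le_mul_left _ (Nat.add_le_add_left (Nat.le_add_right _ _) _))
  refine (ENNReal.ofReal_le_ofReal h₁).trans ?_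
  rw [ENNReal.ofReal_natCast]
  exact_mod_cast h₃

theorem queueMoment_lt_top (harr : ArrivalAssumptions arr) (hsvc : ServiceAssumptions svc)
    (htilt : ∀ m, IsTilted (serviceRate svc) (pol.dispatch m)) {ε : ℝ} (hε : 0 < ε)
    (hrate : arrivalRate arr = ∑ n, serviceRate svc n - ε) {p : ℝ} (hp : 0 < p)
    (hupd : ∀ z ∈ reachable (step arr svc pol) 0, ∀ m n,
      ENNReal.ofReal p ≤ refreshProb arr svc pol z m n)
    {π : PMF (State M N)} (hπ : IsSteadyState (step arr svc pol) 0 π) (r : ℕ) :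
    queueMoment π r < ∞ := by
  obtain ⟨c, δ, K, hδ, -, hdrift⟩ :=
    exists_lyapunov_drift (pol := pol) harr hsvc htilt hε hrate hp r
  have hmean := mean_le_of_drift (reachable_closed 0) (lyapunov_ne_top c r)
    (fun z => ENNReal.mul_ne_top ENNReal.ofReal_ne_top (ENNReal.natCast_ne_top (powSize r z)))
    (fun z hz => hdrift z (hupd z hz)) hπ.1 hπ.2
  rw [mean_const_mul] at hmean
  have hsize : mean π (fun z => (powSize r z : ℝ≥0∞)) < ∞ := by
    by_contra htop
    rw [not_lt, top_le_iff] at htop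
    rw [htop, ENNReal.mul_top (ENNReal.ofReal_pos.2 hδ).ne'] at hmean
    exact ENNReal.ofReal_lt_top.not_ge hmean
  refine (mean_mono (p := π) fun z => ofReal_queueNorm_pow_le z r).trans_lt ?_
  rw [mean_const_mul, mean_add, mean_const]
  exact ENNReal.mul_lt_top (ENNReal.natCast_lt_top _)
    (ENNReal.add_lt_top.2 ⟨ENNReal.one_lt_top, hsize⟩)

/-! ### Access to the empty state -/

theorem step_pos {z : State M N} {w : Slot M N} (hw : w ∈ (slot arr svc pol z).support) :
    0 < step arr svc pol z (w.nextQueue z.1, w.nextEstimate z) := by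
  rw [PMF.apply_pos_iff, step, PMF.mem_support_map_iff]
  exact ⟨w, hw, rfl⟩

theorem ServiceAssumptions.exists_pos (h : ServiceAssumptions svc) (n : Fin N) :
    ∃ s, 0 < s ∧ svc n s ≠ 0 := by
  by_contra! h0
  refine (h.rate_pos n).ne' ?_
  rw [serviceRate]
  convert tsum_zero with s
  rcases Nat.eq_zero_or_pos s with hs | hs
  · simp [hs]
  · simp [h0 s hs]

/-- With positive probability no tasks arrive and every server offers service. -/
theorem exists_slot_drain (harr : ArrivalAssumptions arr) (hsvc : ServiceAssumptions svc)
    (z : State M N) :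
    ∃ w ∈ (slot arr svc pol z).support, w.arrivals = 0 ∧ ∀ n, 0 < w.service n := by
  choose s hs hs0 using hsvc.exists_pos
  obtain ⟨c, hc⟩ := (indep fun m => pol.dispatch m (z.2 m)).support_nonempty
  obtain ⟨u, hu⟩ := (pol.update z 0 c s).support_nonempty
  refine ⟨⟨0, c, s, u⟩, ?_, rfl, hs⟩
  simp only [slot, PMF.mem_support_bind_iff, PMF.mem_support_map_iff]
  refine ⟨0, (PMF.mem_support_iff _ _).2 harr.none_pos.ne', c, hc, s, ?_, u, hu, rfl⟩
  rw [PMF.mem_support_iff, indep_apply]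
  exact Finset.prod_ne_zero_iff.2 fun n _ => hs0 n

theorem Slot.nextQueue_of_arrivals_eq_zero {w : Slot M N} (h : w.arrivals = 0) (q : Fin N → ℕ)
    (n : Fin N) : w.nextQueue q n = q n - w.service n := by
  simp [Slot.nextQueue, Slot.routed, h]

/-- In a slot without arrivals and with positive service everywhere, a common bound on the queues
drops by one. -/
theorem exists_accessible_queue_eq_zero (harr : ArrivalAssumptions arr)
    (hsvc : ServiceAssumptions svc) (z : State M N) :
    ∃ z' : State M N, z'.1 = 0 ∧ Accessible (step arr svc pol) z z' := by
  have key : ∀ (K : ℕ) (z : State M N), (∀ n, z.1 n ≤ K) →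
      ∃ z' : State M N, z'.1 = 0 ∧ Accessible (step arr svc pol) z z' := by
    intro K
    induction K with
    | zero => exact fun z hz => ⟨z, funext fun n => Nat.le_zero.1 (hz n), .refl z⟩
    | succ K ih =>
      intro z hz
      obtain ⟨w, hw, ha, hs⟩ := exists_slot_drain (pol := pol) harr hsvc z
      obtain ⟨z', hz', hacc⟩ := ih (w.nextQueue z.1, w.nextEstimate z) fun n => by
        have h₁ := hz n
        have h₂ := hs n
        show w.nextQueue z.1 n ≤ K
        rw [Slot.nextQueue_of_arrivals_eq_zero ha]
        omega
      exact ⟨z', hz', .head (step_pos hw) hacc⟩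
  exact key (∑ n, z.1 n) z fun n =>
    Finset.single_le_sum (f := z.1) (fun _ _ => Nat.zero_le _) (Finset.mem_univ n)

/-- One chosen estimate is refreshed to `0` per slot. With empty queues and no arrivals, all three
actions preserve the zeros already obtained. -/
theorem exists_accessible_estimates_eq_zero
    (href : ∀ z ∈ reachable (step arr svc pol) 0, z.1 = 0 → ∀ m n,
      0 < (slot arr svc pol z).toOuterMeasure
        {w | w.arrivals = 0 ∧ w.action m n = Action.refresh})
    {z : State M N} (hz : z ∈ reachable (step arr svc pol) 0) (hz0 : z.1 = 0)
    (s : Finset (Fin M × Fin N)) :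
    ∃ z' : State M N, z'.1 = 0 ∧ Accessible (step arr svc pol) z z' ∧
      ∀ i ∈ s, z'.2 i.1 i.2 = 0 := by
  induction s using Finset.induction_on with
  | empty => exact ⟨z, hz0, .refl z, by simp⟩
  | insert i s _ ih =>
    obtain ⟨y, hy0, hzy, hys⟩ := ih
    have hpos := href y (Accessible.trans hz hzy) hy0 i.1 i.2
    obtain ⟨w, hw, ha, hact⟩ : ∃ w ∈ (slot arr svc pol y).support,
        w.arrivals = 0 ∧ w.action i.1 i.2 = Action.refresh := by
      by_contra! hcon
      refine hpos.ne' ((PMF.toOuterMeasure_apply_eq_zero_iff _ _).2 ?_)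
      exact Set.disjoint_left.2 fun w hw hw' => hcon w hw hw'.1 hw'.2
    have hq : ∀ n, w.nextQueue y.1 n = 0 := fun n => by
      simp [Slot.nextQueue_of_arrivals_eq_zero ha, hy0]
    refine ⟨(w.nextQueue y.1, w.nextEstimate y), funext hq, hzy.trans (.of_pos (step_pos hw)), ?_⟩
    intro j hj
    show w.nextEstimate y j.1 j.2 = 0
    rcases Finset.mem_insert.1 hj with rfl | hj
    · simp [Slot.nextEstimate, hact, hq]
    · have hr : w.routed j.1 j.2 = 0 := by simp [Slot.routed, ha]
      unfold Slot.nextEstimate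
      split
      · exact hys j hj
      · rw [hys j hj, hr]
      · exact hq _

theorem accessible_zero (harr : ArrivalAssumptions arr) (hsvc : ServiceAssumptions svc)
    (href : ∀ z ∈ reachable (step arr svc pol) 0, z.1 = 0 → ∀ m n,
      0 < (slot arr svc pol z).toOuterMeasure
        {w | w.arrivals = 0 ∧ w.action m n = Action.refresh})
    {z : State M N} (hz : z ∈ reachable (step arr svc pol) 0) :
    Accessible (step arr svc pol) z 0 := by
  obtain ⟨y, hy0, hzy⟩ := exists_accessible_queue_eq_zero (pol := pol) harr hsvc z
  obtain ⟨x, hx0, hyx, hx⟩ := exists_accessible_estimates_eq_zero href (Accessible.trans hz hzy) hy0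
    Finset.univ
  have : x = 0 := Prod.ext hx0 (funext fun m => funext fun n => hx (m, n) (Finset.mem_univ _))
  exact this ▸ hzy.trans hyx

end LED

end

/-! ### The main theorem -/

open MarkovChain LED in
theorem theorem1 {M N : ℕ} (svc : Fin N → PMF ℕ) (hsvc : ServiceAssumptions svc)
    (pol : Policy M N) (htilt : ∀ m, IsTilted (serviceRate svc) (pol.dispatch m))
    (ε : ℝ) (hε : 0 < ε)
    (arr : PMF (Fin M → ℕ)) (harr : ArrivalAssumptions arr)
    (hrate : arrivalRate arr = ∑ n, serviceRate svc n - ε)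
    (p : ℝ) (hp : 0 < p)
    (hupd : ∀ z ∈ reachable (step arr svc pol) 0, ∀ m n,
      ENNReal.ofReal p ≤ refreshProb arr svc pol z m n) :
    IsPositiveRecurrent (step arr svc pol) 0 ∧
    (∃ π, IsSteadyState (step arr svc pol) 0 π) ∧
    (∀ π, IsSteadyState (step arr svc pol) 0 π → ∀ r : ℕ, queueMoment π r < ⊤) ∧
    -- if the empty state can be reached from every state, then the chain is irreducible and
    -- positive recurrent in the classical sense, with a unique stationary distribution
    ((∀ z ∈ reachable (step arr svc pol) 0, Accessible (step arr svc pol) z 0) →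
      IsIrreducible (step arr svc pol) 0 ∧
      (∀ z ∈ reachable (step arr svc pol) 0, meanHit (step arr svc pol) {z} z < ⊤) ∧
      ∃! π, IsSteadyState (step arr svc pol) 0 π) ∧
    -- and it can, if refreshing an estimate is compatible with having empty queues and no arrivals
    ((∀ z ∈ reachable (step arr svc pol) 0, z.1 = 0 → ∀ m n,
        0 < (slot arr svc pol z).toOuterMeasure
          {w | w.arrivals = 0 ∧ w.action m n = Action.refresh}) →
      ∀ z ∈ reachable (step arr svc pol) 0, Accessible (step arr svc pol) z 0) := by
  obtain ⟨V, F, hF, hfoster⟩ := exists_foster (pol := pol) harr hsvc htilt hε hrate hp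
  have hV : ∀ z ∈ reachable (step arr svc pol) 0, z ∉ F →
      mean (step arr svc pol z) V + 1 ≤ V z := fun z hz => (hfoster z (hupd z hz)).2
  have hfin : ∀ z ∈ reachable (step arr svc pol) 0, mean (step arr svc pol z) V < ⊤ :=
    fun z hz => (hfoster z (hupd z hz)).1
  have hrec : IsPositiveRecurrent (step arr svc pol) 0 := isPositiveRecurrent_of_drift hF hV hfin
  have hex : ∃ π, IsSteadyState (step arr svc pol) 0 π := by
    obtain ⟨x, hx, -⟩ := exists_essential_of_drift hF hV hfin (Accessible.refl 0)
    exact exists_isSteadyState hx.1 (hrec.returns x hx)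
  refine ⟨hrec, hex, fun π hπ r => queueMoment_lt_top harr hsvc htilt hε hrate hp hupd hπ r,
    fun hacc => ?_, fun href z hz => accessible_zero harr hsvc href hz⟩
  have hirr : IsIrreducible (step arr svc pol) 0 := fun x hx y hy => (hacc x hx).trans hy
  have hret : ∀ z ∈ reachable (step arr svc pol) 0, meanHit (step arr svc pol) {z} z < ⊤ :=
    fun z hz => hrec.returns z ⟨hz, fun y hy => hirr y (Accessible.trans hz hy) z hz⟩
  obtain ⟨π, hπ⟩ := hex
  exact ⟨hirr, hret, π, hπ, fun π' hπ' =>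
    hπ'.eq_of_accessible hπ hacc (hret 0 (Accessible.refl 0))⟩
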